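/- Let $k$ be a field of characteristic zero and $S:=k[X_0,X_1,X_2]$. For a $k$-derivation $\partial=G_0\partial_{X_0}+G_1\partial_{X_1}+G_2\partial_{X_2}$ of $S$ and a finite-dimensional $k$-subspace $V\subset S$ with ordered basis $a_0,\dots,a_r$, let $W_\partial(V):=\det(\partial^i(a_j))_{0\le i,j\le r}$, well defined up to a factor in $k^\ast$. Call $\partial$ homogeneous if $G_0,G_1,G_2$ are homogeneous of the same degree; for $F\in S$ call $\partial$ an $F$-derivation if $F\mid\partial(F)$, and let $\gcd(\partial,F)$ be the greatest common divisor of $F$ and the maximal minors of $\begin{bmatrix}X_0&X_1&X_2\\G_0&G_1&G_2\end{bmatrix}$. For $P,Q\in S$ let $\partial_{P,Q}$ be the derivation given by the formal determinant with rows $\nabla(P)$, $\nabla(Q)$, $(\partial_{X_0},\partial_{X_1},\partial_{X_2})$, and let $\varepsilon:=X_0\partial_{X_0}+X_1\partial_{X_1}+X_2\partial_{X_2}$. For homogeneous $F$-derivations $\partial_1,\partial_2$ write $\partial_1\equiv_F\partial_2$ if there is $a\in k^\ast$ such that for each linear form $L$ there are a homogeneous derivation $\partial$ and a homogeneous polynomial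 $N\in S$ with $L(\partial_1-a\partial_2)=F\partial+N\varepsilon$. Let $P\in S$ be a nonzero homogeneous polynomial, $C\subset\mathbb{P}^2_k$ the curve $P=0$, and $V\subset S$ a $k$-vector space of dimension $r+1$, $r\ge 0$, consisting of homogeneous polynomials of one fixed degree (including $0$). Let $R_P(V)\subset\mathbb{P}^2_k$ be the ramification scheme, that is, the closed subscheme cut out on each open set $X_i\ne 0$ ($i=0,1,2$) by $P$ and $W_{\partial_{P,X_i}}(V)$ (these local subschemes glue). For homogeneous $A,B$ let $(A\cdot B)$ be the closed subscheme of $\mathbb{P}^2_k$ cut out by $A$ and $B$. Then: (1) If $Q_1,Q_2\in S$ are nonconstant and homogeneous, then $Q_2\partial_{P,Q_1}\equiv_P Q_1\partial_{P,Q_2}$. (2) For each nonconstant homogeneous polynomial $Q\in S$ prime to $P$, the scheme $R_P(V)$ is finite if and only if $\gcd(W_{\partial_{P,Q}}(V),P)=1$, and in this case $R_P(V)$, $(Q\cdot P)$ and $(W_{\partial_{P,Q}}(V)\cdot P)$ are effective Cartier divisors of $C$ and $$(W_{\partial_{P,Q}}(V)\cdot P)=R_P(V)+\binom{r+1}{2}(Q\cdot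 P)$$ as Cartier divisors of $C$. (3) If $P$ is square-free, then $\gcd(\partial_{P,Q},P)=1$ for each nonconstant homogeneous polynomial $Q\in S$ prime to $P$. (4) Let $\partial$ be a $P$-derivation with $\gcd(\partial,P)=1$. If $P$ is square-free and $V$ is nondegenerate on each geometric irreducible component of $C$ (that is, no irreducible factor of $P$ in $\bar k[X_0,X_1,X_2]$ divides a nonzero element of $V\otimes_k\bar k$, where $\bar k$ is an algebraic closure of $k$), then $\gcd(W_\partial(V),P)=1$. -/

import Mathlib

namespace PlaneRam

open MvPolynomial

universe u

section Algebra

variable {k : Type u} [Field k]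

/-- The polynomial ring `S = k[X₀, X₁, X₂]`. -/
abbrev S (k : Type u) [Field k] : Type u := MvPolynomial (Fin 3) k

/-- The grading of `S` by degree: `grading k d = S_d`. -/
abbrev grading (k : Type u) [Field k] : ℕ → Submodule k (S k) :=
  MvPolynomial.homogeneousSubmodule (Fin 3) k

noncomputable instance (k : Type u) [Field k] : GradedAlgebra (grading k) :=
  MvPolynomial.gradedAlgebra

/-- The Wronskian determinant of `v = [v₀ ⋯ vᵣ]` with respect to a derivation `D`; row `i` is
`D^i(v₀), …, D^i(vᵣ)`. -/
noncomputable def wronskian (D : Derivation k (S k) (S k)) {r : ℕ} (v : Fin (r + 1) → S k) : S k :=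
  Matrix.det (Matrix.of fun i j : Fin (r + 1) => (⇑D)^[(i : ℕ)] (v j))

/-- The possible values of `W_D(V)`, one for each ordered `k`-basis of `V`. Any two of them differ
by a factor in `k \ {0}`. -/
def wronskians (D : Derivation k (S k) (S k)) (V : Submodule k (S k)) : Set (S k) :=
  {w | ∃ (r : ℕ) (b : Module.Basis (Fin (r + 1)) k V), w = wronskian D fun j => (b j : S k)}

/-- The derivation `G₀ ∂_{X₀} + G₁ ∂_{X₁} + G₂ ∂_{X₂}` is homogeneous: `G₀, G₁, G₂` are homogeneous
of one and the same degree. Note that `G i = D (X i)`. -/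
def IsHomogeneousDerivation (D : Derivation k (S k) (S k)) : Prop :=
  ∃ d : ℕ, ∀ i, (D (X i)).IsHomogeneous d

/-- The derivation `∂_{P,Q}`, the determinant with rows `∇ P`, `∇ Q`, `∇`. -/
noncomputable def del (P Q : S k) : Derivation k (S k) (S k) :=
  mkDerivation k ![
    pderiv 1 P * pderiv 2 Q - pderiv 2 P * pderiv 1 Q,
    -(pderiv 0 P * pderiv 2 Q - pderiv 2 P * pderiv 0 Q),
    pderiv 0 P * pderiv 1 Q - pderiv 1 P * pderiv 0 Q]

/-- The Euler derivation `X₀ ∂_{X₀} + X₁ ∂_{X₁} + X₂ ∂_{X₂}`. -/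
noncomputable def euler (k : Type u) [Field k] : Derivation k (S k) (S k) := mkDerivation k X

/-- `D` is an `F`-derivation: `F ∣ D(F)`. -/
def IsDerivationOf (F : S k) (D : Derivation k (S k) (S k)) : Prop := F ∣ D F

/-- `gcd(D, F) = 1`: the polynomial `F` and the maximal minors of the matrix with rows
`X₀, X₁, X₂` and `G₀, G₁, G₂`, where `G i = D (X i)`, have no common factor except units. -/
def IsPrimeTo (D : Derivation k (S k) (S k)) (F : S k) : Prop :=
  ∀ E : S k, E ∣ F → (∀ i j : Fin 3, E ∣ X i * D (X j) - X j * D (X i)) → IsUnit E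

/-- Projective equivalence modulo `F` of two homogeneous `F`-derivations. -/
structure ProjEquiv (F : S k) (D₁ D₂ : Derivation k (S k) (S k)) : Prop where
  homogeneous_left : IsHomogeneousDerivation D₁
  homogeneous_right : IsHomogeneousDerivation D₂
  isDerivationOf_left : IsDerivationOf F D₁
  isDerivationOf_right : IsDerivationOf F D₂
  exists_eq : ∃ a : k, a ≠ 0 ∧ ∀ L : S k, L.IsHomogeneous 1 →
    ∃ (D : Derivation k (S k) (S k)) (N : S k), IsHomogeneousDerivation D ∧
      (∃ n : ℕ, N.IsHomogeneous n) ∧ L • (D₁ - a • D₂) = F • D + N • euler k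

/-- `V` is nondegenerate on each geometric irreducible component of the curve `P = 0`: no
irreducible factor of `P` over an algebraic closure `K` of `k` divides a nonzero element of
`V ⊗ K`, the `K`-span of `V`. -/
def IsNondegenerate (P : S k) (V : Submodule k (S k)) : Prop :=
  ∀ E : S (AlgebraicClosure k), Irreducible E →
    E ∣ MvPolynomial.map (algebraMap k (AlgebraicClosure k)) P →
    ∀ G ∈ Submodule.span (AlgebraicClosure k)
      (MvPolynomial.map (algebraMap k (AlgebraicClosure k)) '' (V : Set (S k))),
      G ≠ 0 → ¬ E ∣ G

end Algebra

section Geometry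

open AlgebraicGeometry CategoryTheory

/-- The projective plane over `k`. -/
noncomputable def P2 (k : Type u) [Field k] : Scheme.{u} := Proj (grading k)

/-- The structure morphism of the projective plane. -/
noncomputable def P2.toSpec (k : Type u) [Field k] : P2 k ⟶ Spec (.of k) :=
  Proj.toSpecZero (grading k) ≫ Spec.map (CommRingCat.ofHom (algebraMap k (grading k 0)))

variable {k : Type u} [Field k]

/-- The affine open subset `X i ≠ 0` of the projective plane. -/
noncomputable def chart (k : Type u) [Field k] (i : Fin 3) : (P2 k).affineOpens :=
  ⟨Proj.basicOpen (grading k) (X i),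
    Proj.isAffineOpen_basicOpen (grading k) (X i) (isHomogeneous_X k i) one_pos⟩

/-- Dehomogenization `G ↦ G(X₀ / X i, X₁ / X i, X₂ / X i)`, with values in the degree-zero part of
`S[1 / X i]`. If `G` is homogeneous of degree `d`, this is `G / (X i) ^ d`. -/
noncomputable def dehomogenize (i : Fin 3) :
    S k →+* HomogeneousLocalization.Away (grading k) (X i) :=
  eval₂Hom
    ((algebraMap (grading k 0) (HomogeneousLocalization.Away (grading k) (X i))).comp
      (algebraMap k (grading k 0)))
    fun j => HomogeneousLocalization.Away.mk (grading k) (isHomogeneous_X k i) 1 (X j)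
      (by simpa using isHomogeneous_X k j)

/-- The regular function on the chart `X i ≠ 0` defined by the dehomogenization of `G`. -/
noncomputable def localEquation (i : Fin 3) (G : S k) : Γ(P2 k, (chart k i).1) :=
  (Proj.awayToSection (grading k) (X i)).hom (dehomogenize i G)

/-- The ideal of regular functions on the chart `X i ≠ 0` generated by a set of polynomials. -/
noncomputable def chartIdeal (i : Fin 3) (T : Set (S k)) : Ideal Γ(P2 k, (chart k i).1) :=
  Ideal.span (localEquation i '' T)

/-- The (ideal sheaf of the) closed subscheme of the plane cut out on each chart `X i ≠ 0` by the
polynomials in `T i`: the largest ideal sheaf that is contained in `chartIdeal i (T i)` on the chart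
`X i ≠ 0` for each `i`. If the three ideals agree on the overlaps, then it restricts to each of
them. -/
noncomputable def cutOut (T : Fin 3 → Set (S k)) : (P2 k).IdealSheafData :=
  sSup {I | ∀ i, I.ideal (chart k i) ≤ chartIdeal i (T i)}

/-- The subscheme `(P · Q)` of the plane cut out by the homogeneous polynomials `P` and `Q`. -/
noncomputable def intersection (P Q : S k) : (P2 k).IdealSheafData := cutOut fun _ => {P, Q}

/-- The curve `P = 0`. -/
noncomputable def curveIdeal (P : S k) : (P2 k).IdealSheafData := cutOut fun _ => {P}

/-- The curve `P = 0`, as a scheme. -/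
noncomputable def curve (P : S k) : Scheme.{u} := (curveIdeal P).subscheme

/-- The embedding of the curve `P = 0` into the plane. -/
noncomputable def curveι (P : S k) : curve P ⟶ P2 k := (curveIdeal P).subschemeι

/-- The ramification scheme `R_P(V)`: on `X i ≠ 0` it is cut out by `P` and the Wronskian
`W_{∂_{P, X i}}(V)`. -/
noncomputable def ramificationScheme (P : S k) (V : Submodule k (S k)) : (P2 k).IdealSheafData :=
  cutOut fun i => {P} ∪ wronskians (del P (X i)) V

/-- The closed subscheme of the plane with ideal sheaf `I` is finite (over `k`). -/
def IsFiniteSubscheme (I : (P2 k).IdealSheafData) : Prop :=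
  IsFinite (I.subschemeι ≫ P2.toSpec k)

/-- An ideal sheaf defines an effective Cartier divisor: locally it is generated by one
nonzerodivisor. Addition of effective Cartier divisors is multiplication of ideal sheaves. -/
def IsEffectiveCartier {Y : Scheme.{u}} (I : Y.IdealSheafData) : Prop :=
  ∀ y : Y, ∃ U : Y.affineOpens, y ∈ U.1 ∧ ∃ f ∈ nonZeroDivisors Γ(Y, U.1), I.ideal U = Ideal.span {f}

/-- The ideal sheaf on the curve `P = 0` that a closed subscheme of the plane cuts out. -/
noncomputable def onCurve (P : S k) (I : (P2 k).IdealSheafData) : (curve P).IdealSheafData :=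
  I.comap (curveι P)

end Geometry

end PlaneRam

/-! The engine is a comparison of Wronskians. Suppose `A D' ≡ B D + N ε` modulo `F` on the
variables, with `F ∣ D' F` and `D` homogeneous. On forms `v j` of one degree, `ε` multiplies `D^m (v
j)` by its degree, which does not depend on `j`. Hence modulo `F` the iterates of `A D'` are
triangular combinations of those of `D`, with diagonal `1, B, B², …`, and the two Wronskians agree
up to the powers of `A` and `B` with exponent `n = (r+1).choose 2` (`wronskian_dvd_sub_of_euler`).

For the derivations `∂_{P,Q}` such a congruence is the vector identity `smul_del_sub_smul_del`,
which already gives (1). Comparing `X j` with `X i`, it shows that the local equations of the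
ramification scheme glue (`ramificationScheme_ideal`). Comparing `Q` with `X i`, it gives
`W_{∂_{P,Q}} = (q Q)^n W_{∂_{P,X i}}` on the chart `X i ≠ 0` of the curve
(`curveHom_wronskian_del`). Since `q` is a unit, this is the divisor formula in (2); forms prime to
`P` are nonzerodivisors on the curve, so all three schemes are Cartier divisors. Finiteness is
tested on charts (`isFiniteSubscheme_iff`): two curves meet in a finite scheme on `X i ≠ 0` exactly
when every common component lies in the line `X i = 0`.

For (3), the minors are the coordinates of `x × (∇P × ∇Q) = q Q ∇P - p P ∇Q`, so a common factor
prime to `Q` would divide all partial derivatives of `P` and be a multiple factor.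

For (4), let an irreducible `E` divide `P` and the Wronskian. By `exists_minor`, `D` may be replaced
by `∂_{E,X i}`. This induces a derivation on the function field of `E = 0`, where the vanishing
Wronskian yields a linear relation among the elements of `V` with constant coefficients. Constants
are algebraic over `k`, so over the algebraic closure a nonzero element of `V` shares a factor with
`E` (`exists_common_factor`), against nondegeneracy. -/

namespace PlaneRam

open MvPolynomial

/-! ### The derivations `∂_{P,Q}` and their projective equivalence modulo `P`. -/

section Derivations

variable {k : Type*} [Field k]

theorem derivation_eq_sum_pderiv (D : Derivation k (S k) (S k)) (f : S k) :
    D f = pderiv 0 f * D (X 0) + pderiv 1 f * D (X 1) + pderiv 2 f * D (X 2) := by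
  have h : D = D (X 0) • pderiv 0 + D (X 1) • pderiv 1 + D (X 2) • pderiv 2 := by
    refine derivation_ext fun i => ?_
    fin_cases i <;> simp [pderiv_X]
  conv_lhs => rw [h]
  simp only [Derivation.add_apply, Derivation.smul_apply, smul_eq_mul]
  ring

theorem dvd_derivation_sub {F : S k} {D D' : Derivation k (S k) (S k)}
    (h : ∀ i, F ∣ D (X i) - D' (X i)) (f : S k) : F ∣ D f - D' f := by
  rw [derivation_eq_sum_pderiv D, derivation_eq_sum_pderiv D']
  have : ∀ a b c x y z x' y' z' : S k, a * x + b * y + c * z - (a * x' + b * y' + c * z') =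
      a * (x - x') + b * (y - y') + c * (z - z') := by intros; ring
  rw [this]
  exact dvd_add (dvd_add ((h 0).mul_left _) ((h 1).mul_left _)) ((h 2).mul_left _)

theorem euler_eq (f : S k) :
    euler k f = X 0 * pderiv 0 f + X 1 * pderiv 1 f + X 2 * pderiv 2 f := by
  rw [derivation_eq_sum_pderiv, euler]
  simp only [mkDerivation_X]
  ring

theorem euler_of_isHomogeneous {f : S k} {d : ℕ} (hf : f.IsHomogeneous d) :
    X 0 * pderiv 0 f + X 1 * pderiv 1 f + X 2 * pderiv 2 f = (d : S k) * f := by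
  have := hf.sum_X_mul_pderiv
  rw [Fin.sum_univ_three] at this
  rw [this, nsmul_eq_mul]

theorem euler_apply_of_isHomogeneous {f : S k} {d : ℕ} (hf : f.IsHomogeneous d) :
    euler k f = (d : S k) * f := by
  rw [euler_eq, euler_of_isHomogeneous hf]

theorem del_X_zero (P Q : S k) :
    del P Q (X 0) = pderiv 1 P * pderiv 2 Q - pderiv 2 P * pderiv 1 Q := by
  simp [del]

theorem del_X_one (P Q : S k) :
    del P Q (X 1) = -(pderiv 0 P * pderiv 2 Q - pderiv 2 P * pderiv 0 Q) := by
  simp [del]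

theorem del_X_two (P Q : S k) :
    del P Q (X 2) = pderiv 0 P * pderiv 1 Q - pderiv 1 P * pderiv 0 Q := by
  simp [del]

theorem del_self_left (P Q : S k) : del P Q P = 0 := by
  rw [derivation_eq_sum_pderiv, del_X_zero, del_X_one, del_X_two]
  ring

theorem del_self_right (P Q : S k) : del P Q Q = 0 := by
  rw [derivation_eq_sum_pderiv, del_X_zero, del_X_one, del_X_two]
  ring

theorem isHomogeneousDerivation_del {P Q : S k} {p q : ℕ} (hP : P.IsHomogeneous p)
    (hQ : Q.IsHomogeneous q) : IsHomogeneousDerivation (del P Q) := by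
  have h : ∀ i j, (pderiv i P * pderiv j Q).IsHomogeneous (p - 1 + (q - 1)) :=
    fun i j => hP.pderiv.mul hQ.pderiv
  refine ⟨p - 1 + (q - 1), fun i => ?_⟩
  fin_cases i
  · simpa only [Fin.zero_eta, del_X_zero] using (h 1 2).sub (h 2 1)
  · simpa only [Fin.mk_one, del_X_one] using ((h 0 2).sub (h 2 0)).neg
  · simpa only [Fin.reduceFinMk, del_X_two] using (h 0 1).sub (h 1 0)

theorem IsHomogeneousDerivation.smul {D : Derivation k (S k) (S k)}
    (hD : IsHomogeneousDerivation D) {F : S k} {d : ℕ} (hF : F.IsHomogeneous d) :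
    IsHomogeneousDerivation (F • D) := by
  obtain ⟨m, hm⟩ := hD
  exact ⟨d + m, fun i => hF.mul (hm i)⟩

theorem IsHomogeneousDerivation.exists_isHomogeneous_apply {D : Derivation k (S k) (S k)}
    (hD : IsHomogeneousDerivation D) (d : ℕ) :
    ∃ d', ∀ f : S k, f.IsHomogeneous d → (D f).IsHomogeneous d' := by
  obtain ⟨m, hm⟩ := hD
  refine ⟨d - 1 + m, fun f hf => ?_⟩
  rw [derivation_eq_sum_pderiv]
  exact ((hf.pderiv.mul (hm 0)).add (hf.pderiv.mul (hm 1))).add (hf.pderiv.mul (hm 2))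

theorem IsHomogeneousDerivation.exists_isHomogeneous_iterate {D : Derivation k (S k) (S k)}
    (hD : IsHomogeneousDerivation D) (d : ℕ) :
    ∃ d' : ℕ → ℕ, ∀ (f : S k), f.IsHomogeneous d → ∀ m, ((⇑D)^[m] f).IsHomogeneous (d' m) := by
  choose g hg using hD.exists_isHomogeneous_apply
  refine ⟨fun m => g^[m] d, fun f hf m => ?_⟩
  induction m with
  | zero => exact hf
  | succ m ih =>
    simp only [Function.iterate_succ_apply'] at ih ⊢
    exact hg _ _ ih

/-- The triple product identity `∇P × (x × w) = x (∇P · w) - w (∇P · x)`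
for `w = ∇Q₁ × ∇Q₂`, combined with Euler's identity. -/
theorem smul_del_sub_smul_del {P Q₁ Q₂ : S k} {p q₁ q₂ : ℕ} (hP : P.IsHomogeneous p)
    (h₁ : Q₁.IsHomogeneous q₁) (h₂ : Q₂.IsHomogeneous q₂) :
    ((q₂ : S k) * Q₂) • del P Q₁ - ((q₁ : S k) * Q₁) • del P Q₂ =
      P • (-(p : S k) • del Q₁ Q₂) + del Q₁ Q₂ P • euler k := by
  have eP := euler_of_isHomogeneous hP
  have e₁ := euler_of_isHomogeneous h₁
  have e₂ := euler_of_isHomogeneous h₂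
  rw [derivation_eq_sum_pderiv (del Q₁ Q₂) P, ← e₁, ← e₂]
  refine derivation_ext fun i => ?_
  fin_cases i
  all_goals
    simp only [Fin.zero_eta, Fin.mk_one, Fin.reduceFinMk, Derivation.add_apply, euler,
      Derivation.sub_apply, Derivation.smul_apply, smul_eq_mul, mkDerivation_X, del_X_zero,
      del_X_one, del_X_two]
  · linear_combination (-(pderiv 1 Q₁ * pderiv 2 Q₂ - pderiv 2 Q₁ * pderiv 1 Q₂)) * eP
  · linear_combination (pderiv 0 Q₁ * pderiv 2 Q₂ - pderiv 2 Q₁ * pderiv 0 Q₂) * eP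
  · linear_combination (-(pderiv 0 Q₁ * pderiv 1 Q₂ - pderiv 1 Q₁ * pderiv 0 Q₂)) * eP

theorem projEquiv_smul_del [CharZero k] {P Q₁ Q₂ : S k} {p q₁ q₂ : ℕ} (hP : P.IsHomogeneous p)
    (h₁ : Q₁.IsHomogeneous q₁) (hq₁ : 0 < q₁) (h₂ : Q₂.IsHomogeneous q₂) (hq₂ : 0 < q₂) :
    ProjEquiv P (Q₂ • del P Q₁) (Q₁ • del P Q₂) where
  homogeneous_left := (isHomogeneousDerivation_del hP h₁).smul h₂
  homogeneous_right := (isHomogeneousDerivation_del hP h₂).smul h₁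
  isDerivationOf_left := by simp [IsDerivationOf, del_self_left]
  isDerivationOf_right := by simp [IsDerivationOf, del_self_left]
  exists_eq := by
    have hq₁' : (q₁ : k) ≠ 0 := Nat.cast_ne_zero.mpr hq₁.ne'
    have hq₂' : (q₂ : k) ≠ 0 := Nat.cast_ne_zero.mpr hq₂.ne'
    -- The scalar comes from dividing `smul_del_sub_smul_del` by `q₂`. The identity holds before
    -- multiplication by a linear form, so `L` is merely carried along.
    refine ⟨(q₁ : k) / q₂, div_ne_zero hq₁' hq₂', fun L hL => ?_⟩
    have hdel := isHomogeneousDerivation_del h₁ h₂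
    obtain ⟨d, hd⟩ := hdel.exists_isHomogeneous_apply p
    have hC : ∀ a : k, (C a : S k).IsHomogeneous 0 := isHomogeneous_C _
    refine ⟨(C (-(p / q₂ : k)) * L) • del Q₁ Q₂, C (q₂ : k)⁻¹ * L * del Q₁ Q₂ P,
      hdel.smul ((hC _).mul hL), ⟨_, ((hC _).mul hL).mul (hd P hP)⟩, ?_⟩
    have key := smul_del_sub_smul_del hP h₁ h₂
    have hinv : (C (q₂ : k)⁻¹ : S k) * (q₂ : S k) = 1 := by
      rw [← map_natCast (C : k →+* S k), ← C_mul, inv_mul_cancel₀ hq₂', C_1]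
    refine derivation_ext fun i => ?_
    have ki := congrArg (fun D : Derivation k (S k) (S k) => D (X i)) key
    simp only [Derivation.add_apply, Derivation.sub_apply, Derivation.smul_apply,
      smul_eq_mul, smul_eq_C_mul, div_eq_mul_inv, C_mul, C_neg, map_natCast] at ki ⊢
    linear_combination C (q₂ : k)⁻¹ * L * ki - L * Q₂ * del P Q₁ (X i) * hinv

end Derivations

end PlaneRam

namespace PlaneRam

open MvPolynomial

/-! ### Change of derivation and change of basis in Wronskians. -/

section Wronskian

variable {k : Type*} [Field k]

theorem dvd_iterate_derivation {F : S k} {D : Derivation k (S k) (S k)} (hD : F ∣ D F) {f : S k}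
    (hf : F ∣ f) : F ∣ D f := by
  obtain ⟨g, rfl⟩ := hf
  rw [Derivation.leibniz, smul_eq_mul, smul_eq_mul]
  exact dvd_add (dvd_mul_right _ _) (hD.mul_left _)

/-- Iterates of `D'` are triangular combinations of iterates of `D`, modulo `F`, if
`D' = B D + T` modulo `F` and `T` acts on the iterates `D^m(v j)` by scalars independent of `j`. -/
theorem exists_iterate_sub_sum_dvd {ι : Type*} {F B : S k} {D D' : Derivation k (S k) (S k)}
    {T : S k → S k} (hF : F ∣ D' F) (hT : ∀ f, F ∣ D' f - (B * D f + T f)) {v : ι → S k}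
    {c : ℕ → S k} (hc : ∀ m j, T ((⇑D)^[m] (v j)) = c m * (⇑D)^[m] (v j)) (i : ℕ) :
    ∃ a : ℕ → S k, a i = B ^ i ∧ (∀ m, i < m → a m = 0) ∧
      ∀ j, F ∣ (⇑D')^[i] (v j) - ∑ m ∈ Finset.range (i + 1), a m * (⇑D)^[m] (v j) := by
  induction i with
  | zero => exact ⟨fun m => if m = 0 then 1 else 0, by simp, fun m hm => by simp [hm.ne'],
      fun j => by simp⟩
  | succ i ih =>
    obtain ⟨a, ha, ha0, h⟩ := ih
    -- Coefficients of `D'` applied to `∑ a m * D^m (v j)`: the Leibniz term, the scalar by which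
    -- `T` acts, and the term `B * D^(m+1)` shifted by one index.
    let a' : ℕ → S k := fun m =>
      D' (a m) + a m * c m + (if m = 0 then 0 else a (m - 1) * B)
    refine ⟨a', by simp [a', ha0, ha, pow_succ], fun m hm => ?_, fun j => ?_⟩
    · have h1 : a m = 0 := ha0 m (by omega)
      have h2 : a (m - 1) = 0 := ha0 _ (by omega)
      simp [a', h1, h2]
    · rw [Function.iterate_succ_apply']
      have e1 := dvd_iterate_derivation hF (h j)
      rw [map_sub, map_sum] at e1
      have e2 : F ∣ ∑ m ∈ Finset.range (i + 1), D' (a m * (⇑D)^[m] (v j)) -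
          ∑ m ∈ Finset.range (i + 2), a' m * (⇑D)^[m] (v j) := by
        have e3 : ∑ m ∈ Finset.range (i + 2), a' m * (⇑D)^[m] (v j) =
            ∑ m ∈ Finset.range (i + 1), ((D' (a m) + a m * c m) * (⇑D)^[m] (v j) +
              a m * B * (⇑D)^[m + 1] (v j)) := by
          simp only [a', add_mul _ _ ((⇑D)^[_] (v j)), Finset.sum_add_distrib]
          rw [Finset.sum_range_succ (fun m => D' (a m) * (⇑D)^[m] (v j)),
            Finset.sum_range_succ (fun m => a m * c m * (⇑D)^[m] (v j)),
            Finset.sum_range_succ' (fun m => (if m = 0 then 0 else a (m - 1) * B) *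
              (⇑D)^[m] (v j)), ha0 (i + 1) (by omega)]
          simp
        rw [e3, ← Finset.sum_sub_distrib]
        refine Finset.dvd_sum fun m _ => ?_
        rw [Derivation.leibniz, smul_eq_mul, smul_eq_mul, Function.iterate_succ_apply']
        have e4 := (hT ((⇑D)^[m] (v j))).mul_left (a m)
        rw [hc] at e4
        convert e4 using 1
        ring
      convert dvd_add e1 e2 using 1
      ring

/-- Modulo `F` the two Wronskian matrices differ by a lower triangular factor with diagonal `B^0, …,
B^r`, whose determinant has exponent `0 + 1 + ⋯ + r`. -/
theorem wronskian_dvd_sub {F B : S k} {D D' : Derivation k (S k) (S k)}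
    {T : S k → S k} (hF : F ∣ D' F) (hT : ∀ f, F ∣ D' f - (B * D f + T f)) {r : ℕ}
    {v : Fin (r + 1) → S k} {c : ℕ → S k}
    (hc : ∀ m j, T ((⇑D)^[m] (v j)) = c m * (⇑D)^[m] (v j)) :
    F ∣ wronskian D' v - B ^ Nat.choose (r + 1) 2 * wronskian D v := by
  choose a ha ha0 h using exists_iterate_sub_sum_dvd hF hT hc
  let M : Matrix (Fin (r + 1)) (Fin (r + 1)) (S k) := .of fun i m => a i m
  have hM : M.det = B ^ Nat.choose (r + 1) 2 := by
    rw [Matrix.det_of_isLowerTriangular M fun i j hij => ha0 _ _ hij]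
    simp only [M, Matrix.of_apply, ha]
    rw [Fin.prod_univ_eq_prod_range (fun i => B ^ i), Finset.prod_pow_eq_pow_sum,
      Finset.sum_range_id, Nat.choose_two_right]
  let q := Ideal.Quotient.mk (Ideal.span {F})
  have hmat : q.mapMatrix (.of fun i j : Fin (r + 1) => (⇑D')^[(i : ℕ)] (v j)) =
      q.mapMatrix (M * .of fun i j : Fin (r + 1) => (⇑D)^[(i : ℕ)] (v j)) := by
    ext i j
    simp only [RingHom.mapMatrix_apply, Matrix.map_apply, Matrix.of_apply, Matrix.mul_apply, q, M]
    rw [Ideal.Quotient.eq, Ideal.mem_span_singleton]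
    have e : ∑ m : Fin (r + 1), a i m * (⇑D)^[m] (v j) =
        ∑ m ∈ Finset.range ((i : ℕ) + 1), a i m * (⇑D)^[m] (v j) := by
      rw [Fin.sum_univ_eq_sum_range (fun m => a i m * (⇑D)^[m] (v j))]
      symm
      refine Finset.sum_subset (Finset.range_subset_range.mpr (by omega)) fun m _ hm => ?_
      rw [ha0 _ _ (by simpa using hm), zero_mul]
    rw [e]
    exact h i j
  rw [← Ideal.mem_span_singleton, ← Ideal.Quotient.eq]
  change q _ = q _
  rw [wronskian, RingHom.map_det, hmat, ← RingHom.map_det, Matrix.det_mul, hM, wronskian]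

/-- The case `F = 0`, `T = 0` of the congruence is an equality. -/
theorem wronskian_smul (A : S k) (D : Derivation k (S k) (S k)) {r : ℕ} (v : Fin (r + 1) → S k) :
    wronskian (A • D) v = A ^ Nat.choose (r + 1) 2 * wronskian D v := by
  have := wronskian_dvd_sub (F := 0) (B := A) (D := D) (D' := A • D) (T := 0) (v := v) (c := 0)
    (by simp) (by simp) (by simp)
  exact sub_eq_zero.mp (zero_dvd_iff.mp this)

/-- Homogeneity of `D` gives all `D^m (v j)`, for fixed `m`, one common degree, so the Euler term
acts by a scalar independent of `j`. Nothing of the kind is needed for `D'`. -/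
theorem wronskian_dvd_sub_of_euler {F A B N : S k} {D D' : Derivation k (S k) (S k)}
    (hF : F ∣ D' F) (hD : IsHomogeneousDerivation D)
    (h : ∀ i, F ∣ A * D' (X i) - (B * D (X i) + N * X i)) {r : ℕ}
    {v : Fin (r + 1) → S k} {e : ℕ} (hv : ∀ j, (v j).IsHomogeneous e) :
    F ∣ A ^ Nat.choose (r + 1) 2 * wronskian D' v - B ^ Nat.choose (r + 1) 2 * wronskian D v := by
  obtain ⟨d, hd⟩ := hD.exists_isHomogeneous_iterate e
  rw [← wronskian_smul]
  refine wronskian_dvd_sub (T := fun f => N * euler k f) (c := fun m => N * (d m : S k)) ?_ ?_ ?_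
  · exact hF.mul_left _
  · have := dvd_derivation_sub (F := F) (D := A • D') (D' := B • D + N • euler k)
      fun i => by simpa [euler] using h i
    simpa using this
  · intro m j
    rw [euler_apply_of_isHomogeneous (hd _ (hv j) m), mul_assoc]

theorem wronskian_del_dvd_sub {P Q₁ Q₂ : S k} {p q₁ q₂ : ℕ} (hP : P.IsHomogeneous p)
    (h₁ : Q₁.IsHomogeneous q₁) (h₂ : Q₂.IsHomogeneous q₂) {r : ℕ}
    {v : Fin (r + 1) → S k} {e : ℕ} (hv : ∀ j, (v j).IsHomogeneous e) :
    P ∣ ((q₂ : S k) * Q₂) ^ Nat.choose (r + 1) 2 * wronskian (del P Q₁) v -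
      ((q₁ : S k) * Q₁) ^ Nat.choose (r + 1) 2 * wronskian (del P Q₂) v := by
  refine wronskian_dvd_sub_of_euler (N := del Q₁ Q₂ P) (by simp [del_self_left])
    (isHomogeneousDerivation_del hP h₂) (fun i => ?_) hv
  have key := congrArg (fun D : Derivation k (S k) (S k) => D (X i))
    (smul_del_sub_smul_del hP h₁ h₂)
  simp only [Derivation.add_apply, Derivation.sub_apply, Derivation.smul_apply, smul_eq_mul,
    euler, mkDerivation_X] at key
  refine ⟨-(p : S k) * del Q₁ Q₂ (X i), ?_⟩
  linear_combination key

theorem exists_isHomogeneous_wronskian {D : Derivation k (S k) (S k)}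
    (hD : IsHomogeneousDerivation D) {r : ℕ} {v : Fin (r + 1) → S k} {e : ℕ}
    (hv : ∀ j, (v j).IsHomogeneous e) : ∃ d, (wronskian D v).IsHomogeneous d := by
  obtain ⟨d, hd⟩ := hD.exists_isHomogeneous_iterate e
  refine ⟨∑ i : Fin (r + 1), d i, ?_⟩
  rw [wronskian, Matrix.det_apply]
  refine IsHomogeneous.sum _ _ _ fun σ _ => ?_
  rw [Units.smul_def, zsmul_eq_mul, ← map_intCast (C : k →+* S k)]
  refine IsHomogeneous.C_mul ?_ _
  rw [← Equiv.sum_comp σ]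
  exact IsHomogeneous.prod _ _ _ fun i _ => hd _ (hv i) _

/-- By `k`-linearity of `D`, a change of basis multiplies the Wronskian matrix by a matrix of
constants. -/
theorem exists_wronskian_eq_C_mul {V : Submodule k (S k)} {r : ℕ}
    (b : Module.Basis (Fin (r + 1)) k V) (D : Derivation k (S k) (S k)) {w : S k}
    (hw : w ∈ wronskians D V) :
    ∃ a : k, w = C a * wronskian D fun j => (b j : S k) := by
  obtain ⟨s, b', rfl⟩ := hw
  obtain rfl : s = r := by
    simpa using Fin.equiv_iff_eq.mp ⟨b'.indexEquiv b⟩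
  refine ⟨(b.toMatrix b').det, ?_⟩
  rw [RingHom.map_det, mul_comm, wronskian, wronskian, ← Matrix.det_mul]
  congr 1
  refine Matrix.ext fun i j => ?_
  simp only [Matrix.of_apply, Matrix.mul_apply, RingHom.mapMatrix_apply, Matrix.map_apply]
  have hb : (b' j : S k) = ∑ m, b.toMatrix b' m j • (b m : S k) := by
    have := congrArg V.subtype (b.sum_toMatrix_smul_self b' j).symm
    rwa [map_sum] at this
  have hlin : ∀ i (f : S k), (⇑D)^[i] f = (D.toLinearMap ^ i) f := by
    intro i f
    rw [Module.End.pow_apply]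
    rfl
  rw [hb, hlin, map_sum]
  exact Finset.sum_congr rfl fun m _ => by
    rw [map_smul, hlin, smul_eq_C_mul, mul_comm]

end Wronskian

end PlaneRam

namespace PlaneRam

open MvPolynomial

/-! ### Factors of forms, finite intersections on an affine chart, and statement (3). -/

section Homogeneous

variable {k : Type*} [Field k]

/-- The homogeneous core of the prime ideal `(E)` is prime and contains `F = E^n G` with `E ∤ G`,
hence contains `E`. So `E` divides each of its own homogeneous components, and for degree reasons
only the top one is nonzero. -/
theorem exists_isHomogeneous_of_irreducible_dvd {E F : S k} (hE : Irreducible E) (hF0 : F ≠ 0)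
    {d : ℕ} (hF : F.IsHomogeneous d) (hEF : E ∣ F) : ∃ d', E.IsHomogeneous d' := by
  have hEp : Prime E := hE.prime
  set I : Ideal (S k) := Ideal.span {E} with hI
  have hIp : I.IsPrime := (Ideal.span_singleton_prime hEp.ne_zero).mpr hEp
  have hcore := hIp.homogeneousCore (𝒜 := grading k)
  have hle : (I.homogeneousCore (grading k)).toIdeal ≤ I := Ideal.toIdeal_homogeneousCore_le _ _
  obtain ⟨G, hFG, hG⟩ := (FiniteMultiplicity.of_prime_left hEp hF0).exists_eq_pow_mul_and_not_dvd
  have hmem : F ∈ (I.homogeneousCore (grading k)).toIdeal :=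
    Ideal.mem_homogeneousCore_of_homogeneous_of_mem ⟨d, hF⟩ (Ideal.mem_span_singleton.mpr hEF)
  rw [hFG] at hmem
  have hEc : E ∈ (I.homogeneousCore (grading k)).toIdeal := by
    rcases hcore.mem_or_mem hmem with h | h
    · exact hcore.mem_of_pow_mem _ h
    · exact absurd (Ideal.mem_span_singleton.mp (hle h)) hG
  have hdvd : ∀ m, E ∣ homogeneousComponent m E := fun m =>
    Ideal.mem_span_singleton.mp (hle (homogeneousComponent_mem_of_mem
      (I.homogeneousCore (grading k)).isHomogeneous hEc m))
  have h0 : ∀ m, m ≠ E.totalDegree → homogeneousComponent m E = 0 := by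
    intro m hm
    by_contra hne
    have h1 : E.totalDegree ≤ m := by
      obtain ⟨c, hc⟩ := hdvd m
      have hc0 : c ≠ 0 := by
        rintro rfl
        exact hne (by rw [hc, mul_zero])
      have := (homogeneousComponent_isHomogeneous m E).totalDegree hne
      rw [hc, totalDegree_mul_of_isDomain hE.ne_zero hc0] at this
      omega
    exact hne (homogeneousComponent_eq_zero _ _ (lt_of_le_of_ne h1 (Ne.symm hm)))
  refine ⟨E.totalDegree, ?_⟩
  have hsum := sum_homogeneousComponent E
  rw [Finset.sum_eq_single_of_mem E.totalDegree (by simp) fun m _ hm => h0 m hm] at hsum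
  rw [← hsum]
  convert homogeneousComponent_isHomogeneous E.totalDegree E using 1
  rw [hsum]

theorem degreeOf_le_of_dvd {E F : S k} (hF : F ≠ 0) (h : E ∣ F) (l : Fin 3) :
    degreeOf l E ≤ degreeOf l F := by
  obtain ⟨c, rfl⟩ := h
  rw [degreeOf_mul_eq (left_ne_zero_of_mul hF) (right_ne_zero_of_mul hF)]
  omega

theorem exists_degreeOf_ne_zero {E : S k} (hE : Irreducible E) : ∃ l, degreeOf l E ≠ 0 := by
  by_contra! h
  have : E.totalDegree = 0 := by
    rw [totalDegree_eq_zero_iff]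
    intro m hm l
    have := le_degreeOf_of_mem_support l hm
    rw [h l] at this
    omega
  rw [totalDegree_eq_zero_iff_eq_C] at this
  apply hE.not_isUnit
  rw [this]
  refine (IsUnit.mk0 _ fun h0 => hE.ne_zero ?_).map C
  rw [this, h0, C_0]

/-- In characteristic zero the partial derivative is nonzero and has strictly smaller degree in `X
l`. -/
theorem not_dvd_pderiv [CharZero k] {E : S k} {l : Fin 3} (hl : degreeOf l E ≠ 0) :
    ¬ E ∣ pderiv l E := by
  intro h
  have hsupp : E.support.Nonempty := by
    rw [Finset.nonempty_iff_ne_empty, Ne, support_eq_empty]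
    rintro rfl
    simp at hl
  have hne : pderiv l E ≠ 0 := by
    obtain ⟨m, hm, hml⟩ := Finset.exists_mem_eq_sup E.support hsupp fun m => m l
    rw [← degreeOf_eq_sup] at hml
    have h1 : m - Finsupp.single l 1 + Finsupp.single l 1 = m :=
      tsub_add_cancel_of_le (Finsupp.single_le_iff.mpr (by omega))
    intro h0
    have h2 := coeff_pderiv (i := l) E (m - Finsupp.single l 1)
    rw [h0, coeff_zero, h1] at h2
    rcases mul_eq_zero.mp h2.symm with h3 | h3
    · exact mem_support_iff.mp hm h3
    · exact Nat.cast_add_one_ne_zero _ h3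
  have h1 := degreeOf_le_of_dvd hne h l
  refine absurd h1 (not_le.mpr ?_)
  rw [degreeOf_lt_iff (Nat.pos_of_ne_zero hl)]
  intro m hm
  rw [mem_support_iff, coeff_pderiv] at hm
  have := le_degreeOf_of_mem_support l (mem_support_iff.mpr (left_ne_zero_of_mul hm))
  simp only [Finsupp.add_apply, Finsupp.single_eq_same] at this
  omega

/-- Two plane curves without a common component outside of a coordinate line `X i = 0` have finite
intersection on the affine plane `X i = 1`. -/
theorem finite_quotient_span {P W : S k} (hP0 : P ≠ 0) {p w : ℕ} (hP : P.IsHomogeneous p)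
    (hW : W.IsHomogeneous w) (i : Fin 3)
    (h : ∀ E : S k, Irreducible E → E ∣ P → E ∣ W → E ∣ X i) :
    Module.Finite k (S k ⧸ Ideal.span {P, W, X i - 1}) := by
  rw [Module.finite_iff_krullDimLE_zero, Ring.krullDimLE_zero_iff]
  intro J hJ
  set q := J.comap (Ideal.Quotient.mk (Ideal.span {P, W, X i - 1})) with hq
  have hqp : q.IsPrime := inferInstance
  have hker : ∀ x ∈ ({P, W, X i - 1} : Set (S k)), x ∈ q := fun x hx => by
    rw [hq, Ideal.mem_comap, Ideal.Quotient.eq_zero_iff_mem.mpr (Ideal.subset_span hx)]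
    exact J.zero_mem
  have hqP : P ∈ q := hker P (by simp)
  have hqW : W ∈ q := hker W (by simp)
  have hqX : X i - 1 ∈ q := hker (X i - 1) (by simp)
  have hX : X i ∉ q := fun hx => hqp.ne_top (q.eq_top_iff_one.mpr (by
    simpa using q.sub_mem hx hqX))
  -- A nonmaximal `q` would give a chain `0 < (E) < q' < q < m` of primes, where `E` is a factor of
  -- `P` in `q` and `q'` is the homogeneous core of `q`. This is too long for a ring of dimension
  -- three.
  suffices hmax : q.IsMaximal by
    have hJq := Ideal.map_comap_of_surjective _ Ideal.Quotient.mk_surjective J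
    rw [← hJq]
    refine (Ideal.map_eq_top_or_isMaximal_of_surjective _ Ideal.Quotient.mk_surjective
      hmax).resolve_left fun htop => hJ.ne_top ?_
    rw [← hJq]
    exact htop
  obtain ⟨E, hEP, hE, hEq⟩ : ∃ E, E ∣ P ∧ Irreducible E ∧ E ∈ q := by
    obtain ⟨s, hs, hsP⟩ := UniqueFactorizationMonoid.exists_prime_factors P hP0
    have : s.prod ∈ q := by
      obtain ⟨u, hu⟩ := hsP
      rw [← hu] at hqP
      exact (hqp.mem_or_mem hqP).resolve_right fun h => hqp.ne_top (q.eq_top_of_isUnit_mem h u.isUnit)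
    obtain ⟨E, hEs, hEq⟩ := (hqp.multiset_prod_mem_iff_exists_mem s).mp this
    exact ⟨E, (Multiset.dvd_prod hEs).trans hsP.dvd, (hs E hEs).irreducible, hEq⟩
  obtain ⟨d, hEd⟩ := exists_isHomogeneous_of_irreducible_dvd hE hP0 hP hEP
  have hcore := hqp.homogeneousCore (𝒜 := grading k)
  set q' := (q.homogeneousCore (grading k)).toIdeal with hq'
  -- The homogeneous ideal `q'` cannot contain `X i - 1`, or it would contain the degree-one
  -- component `X i`.
  have hq'q : q' < q := by
    refine lt_of_le_of_ne (Ideal.toIdeal_homogeneousCore_le _ _) fun heq => hX ?_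
    have h1 : X i - 1 ∈ q' := heq ▸ hqX
    have := homogeneousComponent_mem_of_mem (q.homogeneousCore (grading k)).isHomogeneous h1 1
    rw [map_sub, homogeneousComponent_eq_self (isHomogeneous_X k i), ← C_1,
      homogeneousComponent_of_mem (isHomogeneous_C (Fin 3) (1 : k))] at this
    have h2 : X i ∈ q' := by simpa [hq'] using this
    rwa [heq] at h2
  have hEp := (Ideal.span_singleton_prime hE.ne_zero).mpr hE.prime
  have hEq' : Ideal.span {E} < q' := by
    refine lt_of_le_of_ne ?_ fun heq => ?_
    · rw [Ideal.span_singleton_le_iff_mem]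
      -- The form `E` lies in `q`, hence in the core. In the other case, equality would force `E ∣
      -- W`, so `E ∣ X i` by hypothesis and `X i ∈ q`.
      exact Ideal.mem_homogeneousCore_of_homogeneous_of_mem ⟨d, hEd⟩ hEq
    · have hWq : W ∈ q' := Ideal.mem_homogeneousCore_of_homogeneous_of_mem ⟨w, hW⟩ hqW
      rw [← heq, Ideal.mem_span_singleton] at hWq
      exact hX (q.mem_of_dvd (h E hE hEP hWq) hEq)
  obtain ⟨m, hm, hqm⟩ := q.exists_le_maximal hqp.ne_top
  rcases hqm.eq_or_lt with heq | hlt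
  · rwa [heq]
  exfalso
  have h0 : (⊥ : Ideal (S k)) < Ideal.span {E} := by
    rw [bot_lt_iff_ne_bot, Ne, Ideal.span_singleton_eq_bot]
    exact hE.ne_zero
  have := hm.isPrime
  have hbot : (⊥ : Ideal (S k)).IsPrime := Ideal.isPrime_bot
  have h1 := Ideal.height_add_one_le_of_lt_of_isPrime h0
  have h2 := Ideal.height_add_one_le_of_lt_of_isPrime hEq'
  have h3 := Ideal.height_add_one_le_of_lt_of_isPrime hq'q
  have h4 := Ideal.height_add_one_le_of_lt_of_isPrime hlt
  have h5 := Ideal.height_le_ringKrullDim_of_ne_top (I := m) hm.ne_top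
  rw [ringKrullDim_of_isNoetherianRing, ringKrullDim_eq_zero_of_field] at h5
  have h6 : m.height ≤ 3 := by
    have : ((m.height : ℕ∞) : WithBot ℕ∞) ≤ ((3 : ℕ∞) : WithBot ℕ∞) := by simpa using h5
    exact_mod_cast this
  have h7 : (4 : ℕ∞) ≤ m.height := by
    calc (4 : ℕ∞) = 0 + 1 + 1 + 1 + 1 := by norm_num
      _ ≤ (⊥ : Ideal (S k)).height + 1 + 1 + 1 + 1 := by gcongr; exact zero_le
      _ ≤ _ := by
        refine le_trans ?_ h4
        gcongr
        refine le_trans ?_ h3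
        gcongr
        refine le_trans ?_ h2
        gcongr
  exact absurd (h7.trans h6) (by decide)

/-- The double cross product gives the minors as the coordinates of `q Q ∇P - p P ∇Q`. An
irreducible common factor `E` of `P` and the minors thus divides `∂_l P`, where `l` is chosen with
`E ∤ ∂_l E`; then `E² ∣ P`. -/
theorem isPrimeTo_del [CharZero k] {P Q : S k} {p q : ℕ} (hP : P.IsHomogeneous p) (hP0 : P ≠ 0)
    (hPs : Squarefree P) (hQ : Q.IsHomogeneous q) (hq : 0 < q) (hQP : IsRelPrime Q P) :
    IsPrimeTo (del P Q) P := by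
  intro F hFP hF
  by_contra hu
  obtain ⟨E, hE, hEF⟩ := WfDvdMonoid.exists_irreducible_factor hu (ne_zero_of_dvd_ne_zero hP0 hFP)
  have hEP := hEF.trans hFP
  have hEp := hE.prime
  obtain ⟨l, hl⟩ := exists_degreeOf_ne_zero hE
  have hEd := not_dvd_pderiv hl
  have hEQ : ¬ E ∣ Q := fun h => hE.not_isUnit (hQP h hEP)
  have hqu : IsUnit (q : S k) := by
    rw [← map_natCast (C : k →+* S k)]
    exact (IsUnit.mk0 _ (Nat.cast_ne_zero.mpr hq.ne')).map C
  have eP := euler_of_isHomogeneous hP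
  have eQ := euler_of_isHomogeneous hQ
  have key : ∀ l, E ∣ (q : S k) * (Q * pderiv l P) := by
    have hm := fun i j => hEF.trans (hF i j)
    intro l
    suffices E ∣ (q : S k) * Q * pderiv l P - (p : S k) * P * pderiv l Q by
      have h2 := dvd_add this ((hEP.mul_left (p : S k)).mul_right (pderiv l Q))
      rwa [sub_add_cancel, mul_assoc] at h2
    fin_cases l
    · convert hm 1 2 using 1
      simp only [Fin.zero_eta, del_X_one, del_X_two]
      linear_combination -pderiv 0 P * eQ + pderiv 0 Q * eP
    · convert hm 2 0 using 1
      simp only [Fin.mk_one, del_X_zero, del_X_two]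
      linear_combination -pderiv 1 P * eQ + pderiv 1 Q * eP
    · convert hm 0 1 using 1
      simp only [Fin.reduceFinMk, del_X_zero, del_X_one]
      linear_combination -pderiv 2 P * eQ + pderiv 2 Q * eP
  have hdP : E ∣ pderiv l P :=
    (hEp.dvd_or_dvd ((hqu.dvd_mul_left).mp (key l))).resolve_left hEQ
  obtain ⟨P', rfl⟩ := hEP
  rw [pderiv_mul, dvd_add_left (dvd_mul_right _ _)] at hdP
  obtain ⟨P'', rfl⟩ := (hEp.dvd_or_dvd hdP).resolve_left hEd
  exact hE.not_isUnit (hPs E ⟨P'', by ring⟩)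

end Homogeneous

end PlaneRam

namespace PlaneRam

open MvPolynomial

/-! ### Wronskians, extensions and constants in differential fields. -/

section DifferentialFields

/-- If the Wronskian of a family of elements of a differential field vanishes, then the family is
linearly dependent over the constants. -/
theorem exists_constants_of_det_eq_zero {R L : Type*} [CommRing R] [Field L] [Algebra R L]
    (D : Derivation R L L) {n : ℕ} (u : Fin n → L)
    (h : Matrix.det (Matrix.of fun i j : Fin n => (⇑D)^[(i : ℕ)] (u j)) = 0) :
    ∃ c : Fin n → L, c ≠ 0 ∧ (∀ j, D (c j) = 0) ∧ ∑ j, c j * u j = 0 := by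
  induction n with
  | zero => simp at h
  | succ n ih =>
    by_cases h' : Matrix.det (Matrix.of fun i j : Fin n =>
        (⇑D)^[(i : ℕ)] (u j.castSucc)) = 0
    · obtain ⟨c, hc0, hc, hs⟩ := ih (fun j => u j.castSucc) h'
      refine ⟨Fin.snoc c 0, fun h0 => hc0 ?_, fun j => ?_, ?_⟩
      · ext j
        simpa using congrFun h0 j.castSucc
      · refine Fin.lastCases ?_ (fun j => ?_) j
        · simp
        · simpa using hc j
      · simpa [Fin.sum_univ_castSucc] using hs
    · have hinj : ∀ y : Fin n → L,
          (∀ i : Fin n, ∑ j : Fin n, (⇑D)^[(i : ℕ)] (u j.castSucc) * y j = 0) → y = 0 := by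
        intro y hy
        by_contra hy0
        exact h' (Matrix.exists_mulVec_eq_zero_iff.mp ⟨y, hy0, funext fun i => hy i⟩)
      obtain ⟨x, hx0, hx⟩ := Matrix.exists_mulVec_eq_zero_iff.mpr h
      have hx' : ∀ i : Fin (n + 1), ∑ j, (⇑D)^[(i : ℕ)] (u j) * x j = 0 :=
        fun i => congrFun hx i
      have hlast : x (Fin.last n) ≠ 0 := by
        intro hl
        apply hx0
        have := hinj (fun j => x j.castSucc) fun i => by
          have := hx' i.castSucc
          rw [Fin.sum_univ_castSucc, hl] at this
          simpa using this
        ext j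
        refine Fin.lastCases hl (fun j => ?_) j
        exact congrFun this j
      -- With the last coefficient normalized to `1`, its derivative vanishes. Differentiating row
      -- `i` of the relation and subtracting row `i + 1` shows that the remaining derivatives lie in
      -- the kernel of the nonsingular leading block.
      set c : Fin (n + 1) → L := fun j => x j / x (Fin.last n) with hc
      have hcl : c (Fin.last n) = 1 := div_self hlast
      have hcs : ∀ i : Fin (n + 1), ∑ j, (⇑D)^[(i : ℕ)] (u j) * c j = 0 := fun i => by
        have := congrArg (· / x (Fin.last n)) (hx' i)
        simpa [Finset.sum_div, hc, mul_div_assoc] using this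
      have hDc : (fun j : Fin n => D (c j.castSucc)) = 0 := by
        refine hinj _ fun i => ?_
        have h1 := congrArg D (hcs i.castSucc)
        have h2 := hcs i.succ
        simp only [map_sum, Derivation.leibniz, smul_eq_mul, map_zero, Fin.val_castSucc,
          Finset.sum_add_distrib] at h1
        rw [Fin.sum_univ_castSucc, hcl, Derivation.map_one_eq_zero, mul_zero, add_zero] at h1
        rw [Fin.val_succ] at h2
        simp only [Function.iterate_succ_apply'] at h2
        have h3 : ∑ j, c j * D ((⇑D)^[(i : ℕ)] (u j)) = 0 := by
          simpa only [mul_comm] using h2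
        rwa [h3, add_zero] at h1
      refine ⟨c, fun h0 => ?_, fun j => ?_, ?_⟩
      · rw [h0] at hcl
        exact zero_ne_one hcl
      · refine Fin.lastCases ?_ (fun j => congrFun hDc j) j
        rw [hcl, Derivation.map_one_eq_zero]
      · simpa [mul_comm] using hcs 0

/-- A derivation is a ring homomorphism `b ↦ b + d(b) ε` into the dual numbers over `L`. It sends
nonzerodivisors to units, so it extends to the fraction field. -/
theorem exists_derivation_fractionRing {k B L : Type*} [Field k] [CommRing B] [Algebra k B]
    [Field L] [Algebra k L] [Algebra B L] [IsScalarTower k B L] [IsFractionRing B L]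
    (d : Derivation k B B) :
    ∃ δ : Derivation k L L, ∀ b, δ (algebraMap B L b) = algebraMap B L (d b) := by
  obtain ⟨g, hg⟩ : ∃ g : B →+* L, g = algebraMap B L := ⟨_, rfl⟩
  let f : B →+* TrivSqZeroExt L L :=
    { toFun := fun b => (g b, g (d b))
      map_one' := Prod.ext (by simp only [map_one]; rfl)
        (by simp only [Derivation.map_one_eq_zero, map_zero]; rfl)
      map_zero' := Prod.ext (by simp only [map_zero]; rfl) (by simp only [map_zero]; rfl)
      map_add' := fun a b => Prod.ext (by simp only [map_add]; rfl) (by simp only [map_add]; rfl)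
      map_mul' := fun a b => Prod.ext (by simp only [map_mul]; rfl) (by
        simp only [Derivation.leibniz, smul_eq_mul, map_add, map_mul]
        refine Eq.trans ?_ (TrivSqZeroExt.snd_mul (R := L) (M := L) (g a, g (d a)) (g b, g (d b))).symm
        simp only [TrivSqZeroExt.fst, TrivSqZeroExt.snd, smul_eq_mul, MulOpposite.smul_eq_mul_unop,
          MulOpposite.unop_op]
        ring) }
  have hf : ∀ y : nonZeroDivisors B, IsUnit (f y) := fun y => by
    rw [TrivSqZeroExt.isUnit_iff_isUnit_fst]
    change IsUnit (g y)
    rw [hg]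
    exact IsLocalization.map_units L y
  let F : L →+* TrivSqZeroExt L L := IsLocalization.lift hf
  have hF : ∀ b, F (algebraMap B L b) = f b := fun b => IsLocalization.lift_eq hf b
  have hfst : ∀ x, (F x).fst = x := by
    have : ((TrivSqZeroExt.fstHom L L L).toRingHom.comp F) = RingHom.id L := by
      refine IsLocalization.ringHom_ext (nonZeroDivisors B) (RingHom.ext fun b => ?_)
      change (F (algebraMap B L b)).fst = algebraMap B L b
      rw [hF, ← hg]
      rfl
    exact fun x => DFunLike.congr_fun this x
  have hsnd : ∀ b, (F (algebraMap B L b)).snd = algebraMap B L (d b) := fun b => by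
    rw [hF, ← hg]
    rfl
  have hmul : ∀ a b, (F (a * b)).snd = a * (F b).snd + b * (F a).snd := fun a b => by
    rw [map_mul, TrivSqZeroExt.snd_mul, hfst, hfst, smul_eq_mul, MulOpposite.smul_eq_mul_unop,
      MulOpposite.unop_op, mul_comm b]
  refine ⟨Derivation.mk'
    { toFun := fun x => (F x).snd
      map_add' := fun a b => by rw [map_add, TrivSqZeroExt.snd_add]
      map_smul' := fun c x => by
        rw [Algebra.smul_def, hmul, IsScalarTower.algebraMap_apply k B L, hsnd,
          Derivation.map_algebraMap, map_zero, mul_zero, add_zero, RingHom.id_apply,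
          Algebra.smul_def, IsScalarTower.algebraMap_apply k B L] } hmul, hsnd⟩

/-- Since `δ` is `A`-linear, differentiating `f(x) = 0` gives `f'(x) δ(x) = 0`; if `f'(x) = 0`,
descend to `f'`. -/
theorem derivation_eq_zero_of_isAlgebraic {k L : Type*} [Field k] [CharZero k] [Field L]
    [Algebra k L] (δ : Derivation k L L) (A : Subalgebra k L) (hA : ∀ a ∈ A, δ a = 0) {x : L}
    (hx : IsAlgebraic A x) : δ x = 0 := by
  have : CharZero L := charZero_of_injective_algebraMap (algebraMap k L).injective
  let δA : Derivation A L L := Derivation.mk'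
    { toFun := δ
      map_add' := map_add δ
      map_smul' := fun a y => by
        rw [Subalgebra.smul_def, smul_eq_mul, Derivation.leibniz, hA a a.2]
        simp [Subalgebra.smul_def] }
    δ.leibniz
  have hA0 : CharZero A := charZero_of_injective_algebraMap (algebraMap k A).injective
  have key : ∀ (n : ℕ) (f : Polynomial A), f.natDegree ≤ n → f ≠ 0 → Polynomial.aeval x f = 0 →
      δ x = 0 := by
    intro n
    induction n with
    | zero =>
      intro f hn hf0 hf
      rw [Polynomial.eq_C_of_natDegree_le_zero hn, Polynomial.aeval_C] at hf
      refine absurd ?_ hf0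
      rw [Polynomial.eq_C_of_natDegree_le_zero hn,
        (FaithfulSMul.algebraMap_injective A L) (hf.trans (map_zero _).symm), map_zero]
    | succ n ih =>
      intro f hn hf0 hf
      have h1 : Polynomial.aeval x f.derivative * δ x = 0 := by
        have := δA.map_aeval f x
        rw [hf, map_zero] at this
        exact this.symm
      rcases mul_eq_zero.mp h1 with h2 | h2
      · by_cases hd : f.derivative = 0
        -- In characteristic zero `f` is constant here, which the induction hypothesis already
        -- covers.
        · have h3 := Polynomial.derivative_eq_zero.mp hd
          exact ih f (by omega) hf0 hf
        · refine ih f.derivative ?_ hd h2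
          have := Polynomial.natDegree_derivative_le f
          omega
      · exact h2
  obtain ⟨f, hf0, hf⟩ := hx
  exact key _ f le_rfl hf0 hf

/-- The transcendence degree of `L` is at most one, so a transcendental constant `c` would be a
transcendence basis. Then `t` would be algebraic over `k[c]`, where `δ` vanishes, and `δ t` would be
zero. -/
theorem isAlgebraic_of_derivation_eq_zero {k L : Type*} [Field k] [CharZero k] [Field L]
    [Algebra k L] (δ : Derivation k L L) {t : L} (ht : δ t ≠ 0)
    (hL : ∀ x : L, IsAlgebraic (Algebra.adjoin k {t}) x) {c : L} (hc : δ c = 0) :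
    IsAlgebraic k c := by
  by_contra hc'
  have h1 : AlgebraicIndependent k (fun _ : Unit => c) :=
    algebraicIndependent_unique_type_iff.mpr hc'
  have h2 : Algebra.trdeg k L ≤ 1 := by
    have : Algebra.IsAlgebraic (Algebra.adjoin k {t}) L := ⟨hL⟩
    simpa using Algebra.IsAlgebraic.trdeg_le_cardinalMk k {t}
  have h3 := AlgebraicIndependent.isTranscendenceBasis_of_lift_trdeg_le_of_finite h1
    (by simpa using h2)
  have h4 := h3.isAlgebraic.isAlgebraic t
  refine ht (derivation_eq_zero_of_isAlgebraic δ _ (fun a ha => ?_) h4)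
  induction ha using Algebra.adjoin_induction with
  | mem x hx =>
    obtain ⟨i, rfl⟩ := hx
    exact hc
  | algebraMap r => exact δ.map_algebraMap r
  | add x y _ _ hx hy => rw [map_add, hx, hy, add_zero]
  | mul x y _ _ hx hy => rw [Derivation.leibniz, hx, hy, smul_zero, smul_zero, add_zero]

theorem derivation_eq_zero_of_isAlgebraic_base {k L : Type*} [Field k] [CharZero k] [Field L]
    [Algebra k L] (δ : Derivation k L L) {x : L} (hx : IsAlgebraic k x) : δ x = 0 := by
  refine derivation_eq_zero_of_isAlgebraic δ ⊥ (fun a ha => ?_)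
    (hx.extendScalars (FaithfulSMul.algebraMap_injective k (⊥ : Subalgebra k L)))
  obtain ⟨b, rfl⟩ := Algebra.mem_bot.mp ha
  exact δ.map_algebraMap b

end DifferentialFields

end PlaneRam

namespace PlaneRam

open MvPolynomial

/-! ### Setting `X i = 1` in forms. -/

section Dehomogenization

variable {k : Type*} [Field k]

theorem ringHom_apply_of_isHomogeneous {R : Type*} [CommRing R] {α β : S k →+* R} {u : R}
    (hC : ∀ a, α (C a) = β (C a)) (hX : ∀ m, α (X m) = u * β (X m)) {F : S k} {d : ℕ}
    (hF : F.IsHomogeneous d) : α F = u ^ d * β F := by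
  rw [F.as_sum, map_sum, map_sum, Finset.mul_sum]
  refine Finset.sum_congr rfl fun m hm => ?_
  have hd : m.degree = d := by
    by_contra h
    exact mem_support_iff.mp hm (hF.coeff_eq_zero h)
  rw [monomial_eq, map_mul, map_mul, hC, Finsupp.prod, map_prod, map_prod]
  simp only [map_pow, hX, mul_pow, Finset.prod_mul_distrib]
  rw [Finset.prod_pow_eq_pow_sum, show ∑ i ∈ m.support, m i = d from hd]
  ring

/-- Powers of `X i` are congruent to `1` modulo `X i - 1`, so they can be used to equalize degrees.
-/
theorem exists_isHomogeneous_sub_mem (i : Fin 3) (a : S k) :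
    ∃ (b : S k) (d : ℕ), b.IsHomogeneous d ∧ X i - 1 ∣ a - b := by
  induction a using MvPolynomial.induction_on' with
  | monomial m c => exact ⟨monomial m c, m.degree, isHomogeneous_monomial _ rfl, by simp⟩
  | add p q hp hq =>
    obtain ⟨p', m, hp', hpd⟩ := hp
    obtain ⟨q', n, hq', hqd⟩ := hq
    have hX : ∀ n, (X i ^ n : S k).IsHomogeneous n := fun n => by
      simpa using (isHomogeneous_X k i).pow n
    refine ⟨X i ^ n * p' + X i ^ m * q', n + m, ?_, ?_⟩
    · refine ((hX n).mul hp').add ?_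
      rw [add_comm n m]
      exact (hX m).mul hq'
    · have h1 : ∀ n, X i - 1 ∣ (X i ^ n - 1 : S k) := fun n => sub_one_dvd_pow_sub_one _ n
      have e : p + q - (X i ^ n * p' + X i ^ m * q') =
          (p - p') + (q - q') - (X i ^ n - 1) * p' - (X i ^ m - 1) * q' := by ring
      rw [e]
      exact dvd_sub (dvd_sub (dvd_add hpd hqd) ((h1 n).mul_right _)) ((h1 m).mul_right _)

/-- The substitution of `X m / X i` for `X m`. -/
noncomputable def dehomAway (i : Fin 3) : S k →+* Localization.Away (X i : S k) :=
  eval₂Hom ((algebraMap (S k) (Localization.Away (X i : S k))).comp C)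
    fun m => algebraMap (S k) (Localization.Away (X i : S k)) (X m) *
      IsLocalization.Away.invSelf (X i : S k)

theorem dehomAway_C (i : Fin 3) (a : k) :
    dehomAway i (C a) = algebraMap (S k) (Localization.Away (X i : S k)) (C a) := by
  simp [dehomAway]

theorem dehomAway_X (i m : Fin 3) :
    dehomAway i (X m) = algebraMap (S k) (Localization.Away (X i : S k)) (X m) *
    IsLocalization.Away.invSelf (X i : S k) := by
  simp [dehomAway]

theorem algebraMap_X_mul_invSelf (i : Fin 3) :
    algebraMap (S k) (Localization.Away (X i : S k)) (X i) *
    IsLocalization.Away.invSelf (X i : S k) = 1 := IsLocalization.Away.mul_invSelf _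

theorem algebraMap_eq_pow_mul_dehomAway (i : Fin 3) {F : S k} {d : ℕ} (hF : F.IsHomogeneous d) :
    algebraMap (S k) (Localization.Away (X i : S k)) F =
      algebraMap (S k) (Localization.Away (X i : S k)) (X i) ^ d * dehomAway i F := by
  refine ringHom_apply_of_isHomogeneous (fun a => (dehomAway_C i a).symm) (fun m => ?_) hF
  rw [dehomAway_X, mul_left_comm, algebraMap_X_mul_invSelf, mul_one]

theorem algebraMap_away_injective (i : Fin 3) :
    Function.Injective (algebraMap (S k) (Localization.Away (X i : S k))) :=
  IsLocalization.injective _ (powers_le_nonZeroDivisors_of_noZeroDivisors (X_ne_zero i))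

/-- The substitution `X m ↦ X m / X i` kills `X i - 1` and divides a form of degree `d` by `X i ^
d`; clear denominators. -/
theorem pow_dvd_of_mem_span {i : Fin 3} {E F : S k} {e d : ℕ} (hE : E.IsHomogeneous e)
    (hF : F.IsHomogeneous d) (h : F ∈ Ideal.span {E, X i - 1}) : ∃ m, E ∣ X i ^ m * F := by
  obtain ⟨a, b, hab⟩ := Ideal.mem_span_pair.mp h
  have h1 : dehomAway i (X i - 1 : S k) = 0 := by
    rw [map_sub, map_one, dehomAway_X, algebraMap_X_mul_invSelf, sub_self]
  have h2 : dehomAway i F = dehomAway i a * dehomAway i E := by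
    rw [← hab, map_add, map_mul, map_mul, h1, mul_zero, add_zero]
  obtain ⟨n, c, hc⟩ := IsLocalization.Away.surj (X i : S k) (dehomAway i a)
  refine ⟨n + e, X i ^ d * c, algebraMap_away_injective i ?_⟩
  have hF' := algebraMap_eq_pow_mul_dehomAway i hF
  have hE' := algebraMap_eq_pow_mul_dehomAway i hE
  simp only [map_mul, map_pow] at hc ⊢
  rw [hF', hE', h2, ← hc]
  ring

/-- Each element is congruent to a form modulo `X i - 1`, and a form lies in the ideal only if `E`
divides it, because `E ∤ X i`. Primality thus reduces to that of `E`. -/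
theorem isPrime_span {i : Fin 3} {E : S k} (hE : Irreducible E) {e : ℕ} (hEh : E.IsHomogeneous e)
    (hi : ¬ E ∣ X i) : (Ideal.span {E, X i - 1}).IsPrime := by
  have hEp := hE.prime
  have hle : ∀ a, E ∣ a → a ∈ Ideal.span {E, X i - 1} := fun a ha =>
    Ideal.mem_of_dvd _ ha (Ideal.subset_span (by simp))
  have hle' : ∀ a, X i - 1 ∣ a → a ∈ Ideal.span {E, X i - 1} := fun a ha =>
    Ideal.mem_of_dvd _ ha (Ideal.subset_span (by simp))
  have key : ∀ a d, a.IsHomogeneous d → a ∈ Ideal.span {E, X i - 1} → E ∣ a := by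
    intro a d ha h
    obtain ⟨m, hm⟩ := pow_dvd_of_mem_span hEh ha h
    exact (hEp.dvd_or_dvd hm).resolve_left fun h => hi (hEp.dvd_of_dvd_pow h)
  refine ⟨fun h => hE.not_isUnit (isUnit_of_dvd_one (key 1 0 (isHomogeneous_one _ _) ?_)),
    fun {a b} hab => ?_⟩
  · rw [h]
    trivial
  · obtain ⟨a', m, ha', had⟩ := exists_isHomogeneous_sub_mem i a
    obtain ⟨b', n, hb', hbd⟩ := exists_isHomogeneous_sub_mem i b
    have h1 : a' * b' ∈ Ideal.span {E, X i - 1} := by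
      have e : a' * b' = a * b - ((a - a') * b + a' * (b - b')) := by ring
      rw [e]
      exact sub_mem hab (hle' _ (dvd_add (had.mul_right _) (hbd.mul_left _)))
    rcases hEp.dvd_or_dvd (key _ _ (ha'.mul hb') h1) with h | h
    · left
      simpa using add_mem (hle' _ had) (hle _ h)
    · right
      simpa using add_mem (hle' _ hbd) (hle _ h)

end Dehomogenization

end PlaneRam

namespace PlaneRam

open MvPolynomial

universe u

/-! ### The function field of a component, and relations with algebraic coefficients. -/

section Specialization

variable {k : Type u} [Field k]

/-- The equation for `ψ (X l)` is `E` with `X i = 1`, read as a polynomial in `X l` over `k[X j]`.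
Transcendence of `ψ (X j)` keeps its coefficients from collapsing. -/
theorem isAlgebraic_of_aeval_eq_zero {L : Type*} [Field L] [Algebra k L] (ψ : S k →ₐ[k] L)
    {i j l : Fin 3} (hm : ∀ m, m = i ∨ m = j ∨ m = l) (hij : j ≠ i) (hil : l ≠ i) (hjl : l ≠ j)
    {E : S k} (hE0 : E ≠ 0) {e : ℕ} (hE : E.IsHomogeneous e) (hi : ψ (X i) = 1) (hψ : ψ E = 0)
    (ht : Transcendental k (ψ (X j))) :
    IsAlgebraic (Algebra.adjoin k {ψ (X j)}) (ψ (X l)) := by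
  let f : Fin 3 → Polynomial (Polynomial k) := fun m =>
    if m = i then 1 else if m = j then Polynomial.C Polynomial.X else Polynomial.X
  have fi : f i = 1 := by simp [f]
  have fj : f j = Polynomial.C Polynomial.X := by simp [f, hij]
  have fl : f l = Polynomial.X := by simp [f, hil, hjl]
  let c : k →+* Polynomial (Polynomial k) := Polynomial.C.comp Polynomial.C
  let π : S k →+* Polynomial (Polynomial k) := eval₂Hom c f
  have hπ : π E ≠ 0 := by
    intro h0
    let ρ : Polynomial (Polynomial k) →+* S k :=
      Polynomial.eval₂RingHom (Polynomial.eval₂RingHom C (X j)) (X l)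
    let q := Ideal.Quotient.mk (Ideal.span {(0 : S k), X i - 1})
    have hqi : q (X i) = 1 := by
      rw [← map_one q]
      exact Ideal.Quotient.eq.mpr (Ideal.subset_span (by simp))
    have hq : (q.comp ρ).comp π = q := by
      refine MvPolynomial.ringHom_ext (fun a => by simp [π, ρ, c]) fun m => ?_
      rcases hm m with rfl | rfl | rfl
      · simp [π, fi, hqi]
      · simp [π, fj, ρ]
      · simp [π, fl, ρ]
    have h1 : q E = 0 := by
      rw [← hq]
      simp [h0]
    -- With the zero form as first generator, divisibility says that a power of `X i` times `E` is
    -- zero.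
    obtain ⟨n, hn⟩ := pow_dvd_of_mem_span (isHomogeneous_zero _ _ 0) hE
      (Ideal.Quotient.eq_zero_iff_mem.mp h1)
    exact mul_ne_zero (pow_ne_zero n (X_ne_zero i)) hE0 (zero_dvd_iff.mp hn)
  let t : Algebra.adjoin k {ψ (X j)} := ⟨ψ (X j), Algebra.subset_adjoin rfl⟩
  let g : Polynomial k →ₐ[k] Algebra.adjoin k {ψ (X j)} := Polynomial.aeval t
  have hg : Function.Injective g := by
    have h1 := transcendental_iff_injective.mp ht
    refine Function.Injective.of_comp (f := Subtype.val) ?_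
    convert h1 using 1
    ext p
    exact (Polynomial.aeval_algHom_apply (Algebra.adjoin k {ψ (X j)}).val t p).symm
  refine ⟨(π E).map g.toRingHom, (Polynomial.map_ne_zero_iff hg).mpr hπ, ?_⟩
  rw [Polynomial.aeval_def, Polynomial.eval₂_map]
  have h2 : (Polynomial.eval₂RingHom ((algebraMap (Algebra.adjoin k {ψ (X j)}) L).comp g.toRingHom)
      (ψ (X l))).comp π = ψ.toRingHom := by
    refine MvPolynomial.ringHom_ext (fun a => ?_) fun m => ?_
    · have h4 : ψ (C a) = algebraMap k L a := ψ.commutes a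
      have h3 : g (Polynomial.C a) = algebraMap k _ a := Polynomial.aeval_C _ _
      simp [π, c, h3, h4]
    · rcases hm m with rfl | rfl | rfl
      · simp [π, fi, hi]
      · simp [π, fj, g, t]
      · simp [π, fl]
  have h5 := RingHom.congr_fun h2 E
  exact h5.trans hψ

/-- The function field of the curve `E = 0`, with the derivation induced by `∂_{E, X i}` on the
chart `X i = 1`. -/
theorem exists_differential_function_field [CharZero k] {E : S k} (hE : Irreducible E) {e : ℕ}
    (hEh : E.IsHomogeneous e) {i j l : Fin 3} (hm : ∀ m, m = i ∨ m = j ∨ m = l) (hij : j ≠ i)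
    (hil : l ≠ i) (hjl : l ≠ j) (hl : degreeOf l E ≠ 0) :
    ∃ (L : Type u) (_ : Field L) (_ : Algebra k L) (ψ : S k →ₐ[k] L) (δ : Derivation k L L),
      ψ E = 0 ∧ ψ (X i) = 1 ∧ (∀ f, δ (ψ f) = ψ (del E (X i) f)) ∧ δ (ψ (X j)) ≠ 0 ∧
      ∀ c, δ c = 0 → IsAlgebraic k c := by
  have hEi : ¬ E ∣ X i := fun h => hl (by
    have := degreeOf_le_of_dvd (X_ne_zero i) h l
    rwa [degreeOf_X_of_ne hil, Nat.le_zero] at this)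
  set 𝔭 : Ideal (S k) := Ideal.span {E, X i - 1} with h𝔭
  have hp : 𝔭.IsPrime := isPrime_span hE hEh hEi
  let q : S k →ₐ[k] S k ⧸ 𝔭 := Ideal.Quotient.mkₐ k 𝔭
  have hqs : Function.Surjective q := Ideal.Quotient.mkₐ_surjective k 𝔭
  have hq0 : ∀ x, q x = 0 ↔ x ∈ 𝔭 := fun x => Ideal.Quotient.eq_zero_iff_mem
  -- The derivation kills both generators of `𝔭`, so it preserves `𝔭` and descends to the quotient.
  have hstable : ∀ x, q x = 0 → q (del E (X i) x) = 0 := by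
    intro x hx
    rw [hq0] at hx
    obtain ⟨a, b, rfl⟩ := Ideal.mem_span_pair.mp hx
    rw [hq0]
    simp only [map_add, map_sub, Derivation.leibniz, del_self_left, del_self_right, smul_eq_mul,
      Derivation.map_one_eq_zero, sub_zero, mul_zero, zero_add]
    exact add_mem (Ideal.mul_mem_right _ _ (Ideal.subset_span (by simp)))
      (Ideal.mul_mem_right _ _ (Ideal.subset_span (by simp)))
  obtain ⟨δ, hδ⟩ := exists_derivation_fractionRing (L := FractionRing (S k ⧸ 𝔭))
    (Derivation.liftOfSurjective hqs hstable)
  let ψ : S k →ₐ[k] FractionRing (S k ⧸ 𝔭) := (Algebra.ofId (S k ⧸ 𝔭) _).restrictScalars k |>.comp q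
  have hψ : ∀ f, ψ f = algebraMap (S k ⧸ 𝔭) (FractionRing (S k ⧸ 𝔭)) (q f) := fun f => rfl
  have hψ0 : ∀ f, ψ f = 0 ↔ f ∈ 𝔭 := fun f => by
    rw [hψ, map_eq_zero_iff _ (IsFractionRing.injective _ _), hq0]
  have hδψ : ∀ f, δ (ψ f) = ψ (del E (X i) f) := fun f => by
    rw [hψ, hδ, Derivation.liftOfSurjective_apply, hψ]
  have hψE : ψ E = 0 := (hψ0 E).mpr (Ideal.subset_span (by simp))
  have hψi : ψ (X i) = 1 := by
    rw [← sub_eq_zero, ← map_one ψ, ← map_sub, hψ0]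
    exact Ideal.subset_span (by simp)
  -- Up to sign this is the image of `∂_l E`, a form not divisible by `E`, even after multiplication
  -- by powers of `X i`.
  have hδj : δ (ψ (X j)) ≠ 0 := by
    have hne : ψ (pderiv l E) ≠ 0 := by
      rw [Ne, hψ0]
      intro h
      obtain ⟨n, hn⟩ := pow_dvd_of_mem_span hEh hEh.pderiv h
      rcases hE.prime.dvd_or_dvd hn with h | h
      · exact hEi (hE.prime.dvd_of_dvd_pow h)
      · exact not_dvd_pderiv hl h
    have hdel : del E (X i) (X j) = pderiv l E ∨ del E (X i) (X j) = -pderiv l E := by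
      clear * - hij hil hjl
      fin_cases i <;> fin_cases j <;> fin_cases l <;>
        simp [del_X_zero, del_X_one, del_X_two, pderiv_X] at hij hil hjl ⊢
    rw [hδψ]
    rcases hdel with h | h
    · rwa [h]
    · rwa [h, map_neg, neg_ne_zero]
  have htr : Transcendental k (ψ (X j)) := fun h =>
    hδj (derivation_eq_zero_of_isAlgebraic_base δ h)
  have halg : ∀ x : FractionRing (S k ⧸ 𝔭), IsAlgebraic (Algebra.adjoin k {ψ (X j)}) x := by
    have h1 : ∀ f, IsAlgebraic (Algebra.adjoin k {ψ (X j)}) (ψ f) := by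
      intro f
      induction f using MvPolynomial.induction_on with
      | C a =>
        rw [show ψ (C a) = algebraMap k _ a from ψ.commutes a]
        exact isAlgebraic_algebraMap (R := Algebra.adjoin k {ψ (X j)})
          (A := FractionRing (S k ⧸ 𝔭)) (algebraMap k (Algebra.adjoin k {ψ (X j)}) a)
      | add p q hp hq => rw [map_add]; exact hp.add hq
      | mul_X p m hp =>
        rw [map_mul]
        refine hp.mul ?_
        rcases hm m with rfl | rfl | rfl
        · rw [hψi]
          exact isAlgebraic_one
        · exact isAlgebraic_algebraMap
            (⟨ψ (X m), Algebra.subset_adjoin rfl⟩ : Algebra.adjoin k {ψ (X m)})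
        · exact isAlgebraic_of_aeval_eq_zero ψ hm hij hil hjl hE.ne_zero hEh hψi hψE htr
    intro x
    obtain ⟨a, b, -, rfl⟩ := IsFractionRing.div_surjective (A := S k ⧸ 𝔭) x
    obtain ⟨a, rfl⟩ := hqs a
    obtain ⟨b, rfl⟩ := hqs b
    rw [div_eq_mul_inv]
    exact (h1 a).mul (h1 b).inv
  exact ⟨FractionRing (S k ⧸ 𝔭), inferInstance, inferInstance, ψ, δ, hψE, hψi, hδψ, hδj,
    fun c hc => isAlgebraic_of_derivation_eq_zero δ hδj halg hc⟩

theorem exists_algHom_algebraicClosure (k Ω : Type*) [Field k] [Field Ω] [Algebra k Ω]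
    [IsAlgClosed Ω] :
    ∃ ι : AlgebraicClosure k →ₐ[k] Ω, ∀ x, IsAlgebraic k x → ∃ y, ι y = x :=
  ⟨IsAlgClosed.lift, fun _ hx =>
    hx.isIntegral.mem_range_algHom_of_minpoly_splits (IsAlgClosed.splits _) _⟩

/-- The vanishing Wronskian in the function field `L` gives a relation whose coefficients are
constants, hence algebraic over `k`. Lifted to the algebraic closure, they define a form `g`
vanishing at the generic point given by `ψ`. If `E` and `g` had no common factor there, that point
would be algebraic over `k`, contradicting `δ (ψ (X j)) ≠ 0`. -/
theorem exists_common_factor [CharZero k] {E : S k} (hE : Irreducible E) {e : ℕ}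
    (hEh : E.IsHomogeneous e) {i j l : Fin 3} (hm : ∀ m, m = i ∨ m = j ∨ m = l) (hij : j ≠ i)
    (hil : l ≠ i) (hjl : l ≠ j) (hl : degreeOf l E ≠ 0) {r : ℕ} {v : Fin (r + 1) → S k} {d : ℕ}
    (hv : ∀ m, (v m).IsHomogeneous d) (hW : E ∣ wronskian (del E (X i)) v) :
    ∃ c : Fin (r + 1) → AlgebraicClosure k, c ≠ 0 ∧ ∃ E' : S (AlgebraicClosure k),
      Irreducible E' ∧ E' ∣ map (algebraMap k (AlgebraicClosure k)) E ∧
      E' ∣ ∑ m, c m • map (algebraMap k (AlgebraicClosure k)) (v m) := by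
  obtain ⟨L, _, _, ψ, δ, hψE, hψi, hδψ, hδj, halg⟩ :=
    exists_differential_function_field hE hEh hm hij hil hjl hl
  have hiter : ∀ n f, (⇑δ)^[n] (ψ f) = ψ ((⇑(del E (X i)))^[n] f) := by
    intro n f
    induction n with
    | zero => rfl
    | succ n ih => rw [Function.iterate_succ_apply', ih, hδψ, Function.iterate_succ_apply']
  obtain ⟨c, hc0, hc, hs⟩ := exists_constants_of_det_eq_zero δ (fun m => ψ (v m)) (by
    obtain ⟨g, hg⟩ := hW
    have h1 : ψ (wronskian (del E (X i)) v) = 0 := by rw [hg, map_mul, hψE, zero_mul]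
    rw [wronskian, AlgHom.map_det] at h1
    rw [← h1]
    congr 1
    ext a b
    simp [hiter])
  let K := AlgebraicClosure k
  let Ω := AlgebraicClosure L
  obtain ⟨ι, hι⟩ := exists_algHom_algebraicClosure k Ω
  have hrange : ∀ x : L, IsAlgebraic k x → ∃ y : K, ι y = algebraMap L Ω x :=
    fun x hx => hι _ hx.algebraMap
  choose c' hc' using fun m => hrange (c m) (halg _ (hc m))
  refine ⟨c', fun h0 => hc0 ?_, ?_⟩
  · ext m
    have := hc' m
    rw [h0, Pi.zero_apply, map_zero] at this
    exact ((map_eq_zero_iff _ (algebraMap L Ω).injective).mp this.symm)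
  set g : S K := ∑ m, c' m • map (algebraMap k K) (v m) with hg
  have hgh : g.IsHomogeneous d := by
    refine IsHomogeneous.sum _ _ _ fun m _ => ?_
    rw [smul_eq_C_mul]
    exact ((hv m).map _).C_mul _
  let Φ : S K →+* Ω := eval₂Hom ι.toRingHom fun m => algebraMap L Ω (ψ (X m))
  have hΦ : ∀ f, Φ (map (algebraMap k K) f) = algebraMap L Ω (ψ f) := by
    intro f
    have : (Φ.comp (map (algebraMap k K))) = (algebraMap L Ω).comp ψ.toRingHom := by
      refine MvPolynomial.ringHom_ext (fun a => ?_) fun m => ?_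
      · have h4 : ψ (C a) = algebraMap k L a := ψ.commutes a
        simp [Φ, h4, ← IsScalarTower.algebraMap_apply]
      · simp [Φ]
    exact RingHom.congr_fun this f
  have hΦg : Φ g = 0 := by
    rw [hg, map_sum, ← map_zero (algebraMap L Ω), ← hs, map_sum]
    refine Finset.sum_congr rfl fun m _ => ?_
    rw [smul_eq_C_mul, map_mul, hΦ, map_mul, ← hc']
    simp [Φ]
  have hΦE : Φ (map (algebraMap k K) E) = 0 := by rw [hΦ, hψE, map_zero]
  have hΦX : Φ (X i - 1) = 0 := by simp [Φ, hψi]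
  by_contra! hno
  -- Without a common factor, the coordinate ring of the intersection is finite over `K`. So `X j`
  -- is integral there, and so is its image under `Φ`.
  have hfin := finite_quotient_span (P := map (algebraMap k K) E) (W := g)
    ((map_ne_zero_iff _ (map_injective _ (algebraMap k K).injective)).mpr hE.ne_zero)
    (hEh.map _) hgh i fun E' h1 h2 h3 => absurd h3 (hno E' h1 h2)
  obtain ⟨f, hf, hfX⟩ := Algebra.IsIntegral.isIntegral (R := K)
    (Ideal.Quotient.mk (Ideal.span {map (algebraMap k K) E, g, X i - 1}) (X j))
  have hker : ∀ x ∈ Ideal.span {map (algebraMap k K) E, g, X i - 1}, Φ x = 0 := by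
    intro x hx
    rw [← RingHom.mem_ker]
    refine (Ideal.span_le.mpr ?_) hx
    rintro y (rfl | rfl | rfl)
    · exact hΦE
    · exact hΦg
    · exact hΦX
  let Φ' := Ideal.Quotient.lift _ Φ hker
  have h6 : f.eval₂ ι.toRingHom (algebraMap L Ω (ψ (X j))) = 0 := by
    have := congrArg Φ' hfX
    rw [map_zero, Polynomial.hom_eval₂] at this
    rw [← this]
    congr 1
    · ext a
      change ι a = Φ (C a)
      simp [Φ]
    · simp [Φ', Φ]
  let _ : Algebra K Ω := ι.toRingHom.toAlgebra
  have : IsScalarTower k K Ω := IsScalarTower.of_algebraMap_eq fun a => (ι.commutes a).symm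
  have h7 : IsIntegral k (algebraMap L Ω (ψ (X j))) :=
    isIntegral_trans (R := k) (A := K) _ ⟨f, hf, h6⟩
  have h8 : IsIntegral k (ψ (X j)) :=
    (isIntegral_algebraMap_iff (algebraMap L Ω).injective).mp h7
  exact hδj (derivation_eq_zero_of_isAlgebraic_base δ h8.isAlgebraic)

end Specialization

end PlaneRam

namespace PlaneRam

open MvPolynomial

universe u

/-! ### Reduction of (4) to the derivations `∂_{E,X i}`. -/

section Nondegenerate

variable {k : Type u} [Field k]

/-- A derivation along a curve `E = 0` is, up to a factor and multiples of the Euler derivation,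
equal to `∂_{E, X i}`. The factor is the minor opposite to a partial derivative of `E`. -/
theorem exists_minor {E : S k} (hE : Prime E) {e : ℕ} (hEh : E.IsHomogeneous e)
    {D : Derivation k (S k) (S k)} (hD : E ∣ D E) (hDE : IsPrimeTo D E) {l : Fin 3}
    (hl : ¬ E ∣ pderiv l E) :
    ∃ μ : S k, ¬ E ∣ μ ∧ ∀ i m, E ∣ pderiv l E * X i * D (X m) -
      (μ * del E (X i) (X m) + pderiv l E * D (X i) * X m) := by
  let M : Fin 3 → S k := ![X 1 * D (X 2) - X 2 * D (X 1), X 2 * D (X 0) - X 0 * D (X 2),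
    X 0 * D (X 1) - X 1 * D (X 0)]
  have hx : E ∣ X 0 * pderiv 0 E + X 1 * pderiv 1 E + X 2 * pderiv 2 E := by
    rw [euler_of_isHomogeneous hEh]
    exact dvd_mul_left _ _
  rw [derivation_eq_sum_pderiv] at hD
  obtain ⟨x, hx⟩ := hx
  obtain ⟨y, hy⟩ := hD
  -- Here `M` is the cross product of `x` and `G`, with `G i = D (X i)`. Modulo `E` both vectors are
  -- orthogonal to `∇E`, by Euler's identity and by `E ∣ D E`, so `M` is proportional to `∇E`.
  have hM : ∀ b, E ∣ pderiv l E * M b - M l * pderiv b E := by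
    intro b
    fin_cases l <;> fin_cases b <;> simp only [M, Fin.zero_eta, Fin.mk_one, Fin.reduceFinMk,
      Matrix.cons_val]
    · simp [mul_comm]
    · exact ⟨X 2 * y - D (X 2) * x, by linear_combination X 2 * hy - D (X 2) * hx⟩
    · exact ⟨D (X 1) * x - X 1 * y, by linear_combination D (X 1) * hx - X 1 * hy⟩
    · exact ⟨D (X 2) * x - X 2 * y, by linear_combination D (X 2) * hx - X 2 * hy⟩
    · simp [mul_comm]
    · exact ⟨X 0 * y - D (X 0) * x, by linear_combination X 0 * hy - D (X 0) * hx⟩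
    · exact ⟨X 1 * y - D (X 1) * x, by linear_combination X 1 * hy - D (X 1) * hx⟩
    · exact ⟨D (X 0) * x - X 0 * y, by linear_combination D (X 0) * hx - X 0 * hy⟩
    · simp [mul_comm]
  refine ⟨M l, fun h => hE.not_isUnit ?_, fun i m => ?_⟩
  · have h1 : ∀ b, E ∣ M b := fun b => by
      have := (dvd_sub_left (h.mul_right _)).mp (hM b)
      exact (hE.dvd_or_dvd this).resolve_left hl
    refine hDE E dvd_rfl fun i j => ?_
    fin_cases i <;> fin_cases j <;> simp only [Fin.zero_eta, Fin.mk_one, Fin.reduceFinMk]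
    · simp
    · exact h1 2
    · exact (dvd_sub_comm).mp (h1 1)
    · exact (dvd_sub_comm).mp (h1 2)
    · simp
    · exact h1 0
    · exact h1 1
    · exact (dvd_sub_comm).mp (h1 0)
    · simp
  · obtain ⟨n₀, h₀⟩ := hM 0
    obtain ⟨n₁, h₁⟩ := hM 1
    obtain ⟨n₂, h₂⟩ := hM 2
    simp only [show M 0 = X 1 * D (X 2) - X 2 * D (X 1) from rfl] at h₀
    simp only [show M 1 = X 2 * D (X 0) - X 0 * D (X 2) from rfl] at h₁
    simp only [show M 2 = X 0 * D (X 1) - X 1 * D (X 0) from rfl] at h₂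
    generalize M l = μ at *
    fin_cases i <;> fin_cases m <;> simp [del_X_zero, del_X_one, del_X_two, pderiv_X]
    · exact ⟨0, by ring⟩
    · exact ⟨n₂, by linear_combination h₂⟩
    · exact ⟨-n₁, by linear_combination -h₁⟩
    · exact ⟨-n₂, by linear_combination -h₂⟩
    · exact ⟨0, by ring⟩
    · exact ⟨n₀, by linear_combination h₀⟩
    · exact ⟨n₁, by linear_combination h₁⟩
    · exact ⟨-n₀, by linear_combination -h₀⟩
    · exact ⟨0, by ring⟩

theorem exists_third (i j : Fin 3) (h : i ≠ j) :
    ∃ l, l ≠ i ∧ l ≠ j ∧ ∀ m, m = i ∨ m = l ∨ m = j := by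
  revert i j
  decide

/-- Applying a `k`-linear functional of `K` to all coefficients turns a relation over `K` into one
over `k`; choose the functional nonzero on a nonzero `c j`. -/
theorem linearIndependent_map {K : Type*} [Field K] [Algebra k K] {r : ℕ} {v : Fin r → S k}
    (hv : LinearIndependent k v) {c : Fin r → K} (h : ∑ m, c m • map (algebraMap k K) (v m) = 0) :
    c = 0 := by
  by_contra hc
  obtain ⟨j, hj⟩ := Function.ne_iff.mp hc
  obtain ⟨φ, hφ⟩ : ∃ φ : Module.Dual k K, φ (c j) ≠ 0 := by
    by_contra! hφ
    exact hj ((Module.forall_dual_apply_eq_zero_iff k _).mp hφ)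
  refine hφ (Fintype.linearIndependent_iff.mp hv (fun m => φ (c m)) ?_ j)
  ext n
  have := congrArg (fun f => φ (coeff n f)) h
  simp only [coeff_sum, coeff_smul, coeff_map, coeff_zero, map_zero, map_sum, smul_eq_mul] at this ⊢
  rw [← this]
  refine Finset.sum_congr rfl fun m _ => ?_
  rw [mul_comm (c m), ← Algebra.smul_def, map_smul, smul_eq_mul, mul_comm]

theorem isRelPrime_wronskian [CharZero k] {P : S k} {p : ℕ} (hP : P.IsHomogeneous p) (hP0 : P ≠ 0)
    {V : Submodule k (S k)} {e : ℕ} (hV : V ≤ grading k e) {r : ℕ}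
    (b : Module.Basis (Fin (r + 1)) k V) {D : Derivation k (S k) (S k)} (hD : P ∣ D P)
    (hDP : IsPrimeTo D P) (hPs : Squarefree P) (hPV : IsNondegenerate P V) :
    IsRelPrime (wronskian D fun j => (b j : S k)) P := by
  have hb : ∀ j, (b j : S k).IsHomogeneous e := fun j => hV (b j).2
  intro F hFW hFP
  by_contra hu
  obtain ⟨E, hE, hEF⟩ := WfDvdMonoid.exists_irreducible_factor hu (ne_zero_of_dvd_ne_zero hP0 hFP)
  have hEP := hEF.trans hFP
  have hEW := hEF.trans hFW
  obtain ⟨d, hEh⟩ := exists_isHomogeneous_of_irreducible_dvd hE hP0 hP hEP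
  obtain ⟨l, hl⟩ := exists_degreeOf_ne_zero hE
  obtain ⟨i, hil⟩ : ∃ i, l ≠ i := ⟨l + 1, by simp⟩
  obtain ⟨j, hji, hjl, hm⟩ := exists_third i l hil.symm
  -- Since `E` is a simple factor of `P`, the Leibniz rule passes the divisibility from `P` to `E`.
  have hDE : E ∣ D E := by
    obtain ⟨P', rfl⟩ := hEP
    have h1 := (dvd_mul_right E P').trans hD
    rw [Derivation.leibniz, smul_eq_mul, smul_eq_mul, dvd_add_right (dvd_mul_right _ _)] at h1
    refine (hE.prime.dvd_or_dvd h1).resolve_left ?_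
    rintro ⟨P'', rfl⟩
    exact hE.not_isUnit (hPs E ⟨P'', by ring⟩)
  have hld := not_dvd_pderiv hl
  obtain ⟨μ, hμ, hcong⟩ := exists_minor hE.prime hEh hDE (fun F h1 h2 => hDP F (h1.trans hEP) h2) hld
  -- Only `∂_{E,X i}` has to be homogeneous here, so `D` may be arbitrary. Its multiplier `μ` is
  -- prime to `E` and can be cancelled.
  have h1 := wronskian_dvd_sub_of_euler (D := del E (X i)) hDE
    (isHomogeneousDerivation_del hEh (isHomogeneous_X k i)) (hcong i) hb
  have h2 : E ∣ wronskian (del E (X i)) fun j => (b j : S k) :=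
    (hE.prime.dvd_or_dvd ((dvd_sub_right (hEW.mul_left _)).mp h1)).resolve_left
      fun h => hμ (hE.prime.dvd_of_dvd_pow h)
  obtain ⟨c, hc0, E', hE', hE'E, hE'g⟩ :=
    exists_common_factor hE hEh hm hji hil hjl.symm hl hb h2
  refine hPV E' hE' (hE'E.trans (map_dvd _ hEP)) _ ?_ ?_ hE'g
  · exact Submodule.sum_mem _ fun m _ => Submodule.smul_mem _ _
      (Submodule.subset_span ⟨_, (b m).2, rfl⟩)
  · exact fun h => hc0 (linearIndependent_map
      (b.linearIndependent.map' V.subtype (Submodule.ker_subtype V)) h)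

end Nondegenerate

end PlaneRam

namespace PlaneRam

universe u

/-! ### Gluing ideals on affine opens, and restriction to a closed subscheme. -/

section IdealSheaf

open AlgebraicGeometry CategoryTheory TopologicalSpace Scheme

theorem ker_app_fromSpec {X : Scheme.{u}} {U : X.Opens} (hU : IsAffineOpen U) (J : Ideal Γ(X, U)) :
    RingHom.ker ((Spec.map (CommRingCat.ofHom (Ideal.Quotient.mk J)) ≫ hU.fromSpec).app U).hom =
      J := by
  have h : (Spec.map (CommRingCat.ofHom (Ideal.Quotient.mk J)) ≫ hU.fromSpec).app U =
      CommRingCat.ofHom (Ideal.Quotient.mk J) ≫ (Scheme.ΓSpecIso (.of (Γ(X, U) ⧸ J))).inv ≫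
        (Spec (.of (Γ(X, U) ⧸ J))).presheaf.map (eqToHom (by
          rw [Scheme.Hom.comp_preimage, hU.fromSpec_preimage_self]; rfl)).op := by
    rw [Scheme.Hom.comp_app, hU.fromSpec_app_self, Category.assoc, Scheme.Hom.naturality,
      Scheme.ΓSpecIso_inv_naturality_assoc]
    rfl
  rw [h]
  ext x
  rw [RingHom.mem_ker, CommRingCat.comp_apply]
  rw [map_eq_zero_iff _ (ConcreteCategory.injective_of_mono_of_preservesPullback _)]
  exact Ideal.Quotient.eq_zero_iff_mem

theorem presheaf_map_injective {X : Scheme.{u}} {V W : X.Opens} (h : W = V) (i : W ⟶ V) :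
    Function.Injective (X.presheaf.map i.op) := by
  subst h
  rw [Subsingleton.elim i (𝟙 _), op_id, X.presheaf.map_id]
  exact fun _ _ h => h

/-- Ideals on affine open subsets that agree on the overlaps come from one ideal sheaf. -/
theorem exists_idealSheafData {X : Scheme.{u}} [X.IsSeparated] {ι : Type*} [Finite ι]
    (U : ι → X.affineOpens) (J : ∀ i, Ideal Γ(X, (U i).1))
    (h : ∀ i j, (J j).map (X.presheaf.map (homOfLE inf_le_right : (U i).1 ⊓ (U j).1 ⟶ _).op).hom ≤
      (J i).map (X.presheaf.map (homOfLE inf_le_left : (U i).1 ⊓ (U j).1 ⟶ _).op).hom) :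
    ∃ I : X.IdealSheafData, ∀ i, I.ideal (U i) = J i := by
  let f := fun i => Spec.map (CommRingCat.ofHom (Ideal.Quotient.mk (J i))) ≫ (U i).2.fromSpec
  have hker : ∀ i j, (f i).ker.ideal (U j) = RingHom.ker ((f i).app (U j).1).hom :=
    fun i j => Scheme.Hom.ker_apply _ _
  have hself : ∀ i, RingHom.ker ((f i).app (U i).1).hom = J i := fun i => ker_app_fromSpec _ _
  -- The glued subscheme is the union of the scheme-theoretic images of the pieces `Spec (Γ(U i) / J
  -- i)`.
  refine ⟨⨅ i, (f i).ker, fun j => ?_⟩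
  rw [Scheme.IdealSheafData.ideal_iInf, iInf_apply]
  refine le_antisymm ((iInf_le _ j).trans ?_) (le_iInf fun i => ?_)
  · rw [hker, hself]
  · rw [hker]
    intro y hy
    -- The piece `f i` lies over `U i`, so vanishing over `U j` may be tested over the overlap,
    -- where `y` belongs to the ideal generated by `J i`.
    have hpre : f i ⁻¹ᵁ ((U i).1 ⊓ (U j).1) = f i ⁻¹ᵁ (U j).1 := by
      rw [Scheme.Hom.preimage_inf]
      refine inf_eq_right.mpr (le_of_le_of_eq le_top ?_)
      rw [Scheme.Hom.comp_preimage, (U i).2.fromSpec_preimage_self]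
      rfl
    have h1 : ((f i).app ((U i).1 ⊓ (U j).1)).hom
        ((X.presheaf.map (homOfLE inf_le_right : (U i).1 ⊓ (U j).1 ⟶ _).op).hom y) = 0 := by
      rw [← RingHom.mem_ker]
      refine (le_trans (h i j) ?_) (Ideal.mem_map_of_mem _ hy)
      rw [Ideal.map_le_iff_le_comap]
      intro x hx
      rw [Ideal.mem_comap, RingHom.mem_ker, ← CommRingCat.comp_apply, Scheme.Hom.naturality,
        CommRingCat.comp_apply]
      have : ((f i).app (U i).1).hom x = 0 := by
        rw [← RingHom.mem_ker, hself]
        exact hx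
      erw [this, map_zero]
    rw [← CommRingCat.comp_apply, Scheme.Hom.naturality, CommRingCat.comp_apply] at h1
    rw [RingHom.mem_ker]
    exact (map_eq_zero_iff _ (presheaf_map_injective hpre _)).mp h1

/-- The subscheme of `I ⊔ f.ker` factors through `f`, so the pushforward of `I.comap f` is at most
`I ⊔ f.ker`. As sections lift along `f`, modulo its kernel only `I` contributes. -/
theorem ideal_comap_of_isClosedImmersion {X Y : Scheme.{u}} (I : Y.IdealSheafData) (f : X ⟶ Y)
    [IsClosedImmersion f] (U : Y.affineOpens) :
    (I.comap f).ideal ⟨f ⁻¹ᵁ U.1, U.2.preimage f⟩ = (I.ideal U).map (f.app U.1).hom := by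
  refine le_antisymm (fun x hx => ?_) ?_
  · obtain ⟨y, rfl⟩ := f.app_surjective U.1 U.2 x
    have h1 : (I.comap f).map f ≤ I ⊔ f.ker := by
      let g := IsClosedImmersion.lift f (I ⊔ f.ker).subschemeι
        (by rw [Scheme.IdealSheafData.ker_subschemeι]; exact le_sup_right)
      have hg : g ≫ f = (I ⊔ f.ker).subschemeι := IsClosedImmersion.lift_fac _ _ _
      have hM : I ⊔ f.ker = g.ker.map f := by
        rw [Scheme.IdealSheafData.map_ker, hg, Scheme.IdealSheafData.ker_subschemeι]
      rw [hM]
      refine Scheme.IdealSheafData.map_mono _ ?_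
      rw [← Scheme.IdealSheafData.le_map_iff_comap_le, ← hM]
      exact le_sup_left
    have h2 : y ∈ I.ideal U ⊔ RingHom.ker (f.app U.1).hom := by
      rw [← Scheme.Hom.ker_apply]
      refine h1 U ?_
      rw [Scheme.IdealSheafData.ideal_map_of_isAffineHom]
      exact hx
    obtain ⟨a, ha, b, hb, rfl⟩ := Submodule.mem_sup.mp h2
    rw [map_add, show (f.app U.1).hom b = 0 from hb, add_zero]
    exact Ideal.mem_map_of_mem _ ha
  · rw [Ideal.map_le_iff_le_comap, ← Scheme.IdealSheafData.ideal_map_of_isAffineHom]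
    exact I.le_map_comap f U

end IdealSheaf

end PlaneRam

namespace PlaneRam

open MvPolynomial

universe u

/-! ### Functions on the charts of the plane and their transition on overlaps. -/

section Charts

open AlgebraicGeometry CategoryTheory HomogeneousLocalization

variable {k : Type u} [Field k]

theorem X_mem_grading (i : Fin 3) : (X i : S k) ∈ grading k 1 := isHomogeneous_X k i

theorem dehomogenize_X (i m : Fin 3) : dehomogenize (k := k) i (X m) =
    Away.mk (grading k) (X_mem_grading i) 1 (X m) (by simpa using X_mem_grading m) :=
  eval₂Hom_X' _ _ _

theorem dehomogenize_C (i : Fin 3) (a : k) : dehomogenize i (C a) =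
    fromZeroRingHom (grading k) _ (algebraMap k (grading k 0) a) :=
  eval₂Hom_C _ _ _

/-- Lets identities in the degree-zero part be checked in the full localization, where forms can be
compared directly. -/
theorem val_dehomogenize (i : Fin 3) (G : S k) : (dehomogenize i G).val = dehomAway i G := by
  have h : (algebraMap (Away (grading k) (X i : S k)) (Localization.Away (X i : S k))).comp
      (dehomogenize i) = dehomAway i := by
    refine MvPolynomial.ringHom_ext (fun a => ?_) fun m => ?_
    · rw [dehomAway_C, RingHom.comp_apply, dehomogenize_C]
      rfl
    · rw [dehomAway_X, RingHom.comp_apply, dehomogenize_X,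
        HomogeneousLocalization.algebraMap_apply, Away.val_mk, Localization.mk_eq_mk', IsLocalization.Away.invSelf]
      rw [IsLocalization.mk'_eq_mul_mk'_one]
      congr 2
      simp
  exact RingHom.congr_fun h G

theorem exists_dehomogenize_eq (i : Fin 3) (a : Away (grading k) (X i : S k)) :
    ∃ (G : S k) (n : ℕ), G.IsHomogeneous n ∧ dehomogenize i G = a := by
  obtain ⟨n, G, hG, rfl⟩ := Away.mk_surjective (grading k) (X_mem_grading i) a
  have hG' : G.IsHomogeneous n := by simpa using hG
  refine ⟨G, n, hG', val_injective _ ?_⟩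
  rw [val_dehomogenize, Away.val_mk, Localization.mk_eq_mk', eq_comm,
    IsLocalization.mk'_eq_iff_eq_mul, algebraMap_eq_pow_mul_dehomAway i hG', map_pow, mul_comm]

theorem dehomogenize_surjective (i : Fin 3) :
    Function.Surjective (dehomogenize (k := k) i) := fun a =>
  let ⟨G, _, _, h⟩ := exists_dehomogenize_eq i a
  ⟨G, h⟩

theorem dehomogenize_X_self (i : Fin 3) : dehomogenize (k := k) i (X i) = 1 := by
  refine val_injective _ ?_
  rw [val_dehomogenize, dehomAway_X, algebraMap_X_mul_invSelf, val_one]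

theorem pow_dvd_of_dehomogenize_dvd {i : Fin 3} {F G : S k} {f g : ℕ} (hF : F.IsHomogeneous f)
    (hG : G.IsHomogeneous g) (h : dehomogenize i G ∣ dehomogenize i F) :
    ∃ m, G ∣ X i ^ m * F := by
  obtain ⟨a, ha⟩ := h
  obtain ⟨B, b, hB, rfl⟩ := exists_dehomogenize_eq i a
  have h1 := congrArg HomogeneousLocalization.val ha
  rw [val_mul, val_dehomogenize, val_dehomogenize, val_dehomogenize] at h1
  refine ⟨g + b, X i ^ f * B, algebraMap_away_injective i ?_⟩
  simp only [map_mul, map_pow, algebraMap_eq_pow_mul_dehomAway i hF,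
    algebraMap_eq_pow_mul_dehomAway i hG, algebraMap_eq_pow_mul_dehomAway i hB, h1]
  ring

theorem dehomogenize_dvd_of_pow_dvd {i : Fin 3} {F G : S k} {m : ℕ} (h : G ∣ X i ^ m * F) :
    dehomogenize i G ∣ dehomogenize i F := by
  have := map_dvd (dehomogenize i) h
  rwa [map_mul, map_pow, dehomogenize_X_self, one_pow, one_mul] at this

/-- A form prime to `P` is a nonzerodivisor on each chart of the curve `P = 0`. -/
theorem dehomogenize_dvd_of_dvd_mul {i : Fin 3} {P Q : S k} {p q : ℕ} (hP : P.IsHomogeneous p)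
    (hQ : Q.IsHomogeneous q) (hQP : IsRelPrime Q P) {a : Away (grading k) (X i : S k)}
    (h : dehomogenize i P ∣ dehomogenize i Q * a) : dehomogenize i P ∣ a := by
  obtain ⟨A, d, hA, rfl⟩ := exists_dehomogenize_eq i a
  rw [← map_mul] at h
  obtain ⟨m, hm⟩ := pow_dvd_of_dehomogenize_dvd (hQ.mul hA) hP h
  rw [mul_left_comm] at hm
  exact dehomogenize_dvd_of_pow_dvd (hQP.symm.dvd_of_dvd_mul_left hm)

theorem bijective_awayToSection (i : Fin 3) :
    Function.Bijective (Proj.awayToSection (grading k) (X i : S k)).hom :=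
  (Proj.basicOpenIsoAway (grading k) (X i : S k) (isHomogeneous_X k i)
    one_pos).commRingCatIsoToRingEquiv.bijective

theorem localEquation_surjective (i : Fin 3) :
    Function.Surjective (localEquation (k := k) i) := fun a => by
  obtain ⟨b, rfl⟩ := (bijective_awayToSection i).2 a
  obtain ⟨G, rfl⟩ := dehomogenize_surjective i b
  exact ⟨G, rfl⟩

/-- `localEquation i` as a ring homomorphism. -/
noncomputable def localEquationHom (i : Fin 3) : S k →+* Γ(P2 k, (chart k i).1) :=
  (Proj.awayToSection (grading k) (X i)).hom.comp (dehomogenize i)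

theorem localEquationHom_apply (i : Fin 3) (G : S k) :
    localEquationHom i G = localEquation i G := rfl

theorem localEquation_dvd_iff (i : Fin 3) (F : S k) (a : Away (grading k) (X i : S k)) :
    localEquation i F ∣ (Proj.awayToSection (grading k) (X i)).hom a ↔ dehomogenize i F ∣ a := by
  let e := (Proj.basicOpenIsoAway (grading k) (X i : S k) (isHomogeneous_X k i)
    one_pos).commRingCatIsoToRingEquiv
  exact map_dvd_iff e

theorem localEquation_dvd_of_dvd_mul {i : Fin 3} {P Q : S k} {p q : ℕ} (hP : P.IsHomogeneous p)
    (hQ : Q.IsHomogeneous q) (hQP : IsRelPrime Q P) {a : Γ(P2 k, (chart k i).1)}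
    (h : localEquation i P ∣ localEquation i Q * a) : localEquation i P ∣ a := by
  obtain ⟨b, rfl⟩ := (bijective_awayToSection i).2 a
  rw [localEquation_dvd_iff]
  refine dehomogenize_dvd_of_dvd_mul hP hQ hQP ?_
  rw [← localEquation_dvd_iff, map_mul]
  exact h

theorem pow_dvd_of_localEquation_dvd {i : Fin 3} {F G : S k} {f g : ℕ} (hF : F.IsHomogeneous f)
    (hG : G.IsHomogeneous g) (h : localEquation i G ∣ localEquation i F) :
    ∃ m, G ∣ X i ^ m * F :=
  pow_dvd_of_dehomogenize_dvd hF hG ((localEquation_dvd_iff i G _).mp h)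

theorem localEquation_X_self (i : Fin 3) : localEquation (k := k) i (X i) = 1 := by
  rw [localEquation, dehomogenize_X_self]
  exact map_one (Proj.awayToSection (grading k) (X i : S k)).hom

/-- Restriction of the local equations on the chart `X i ≠ 0` to an open subset. -/
noncomputable def restrictHom (i : Fin 3) {U : (P2 k).Opens} (h : U ≤ (chart k i).1) :
    S k →+* Γ(P2 k, U) :=
  ((P2 k).presheaf.map (homOfLE h).op).hom.comp (localEquationHom i)

theorem restrictHom_basicOpen (i j : Fin 3) {x : S k} (hx : x = X i * X j)
    (h : Proj.basicOpen (grading k) x ≤ (chart k i).1) (G : S k) :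
    restrictHom i h G = (Proj.awayToSection (grading k) x).hom
      (awayMap (grading k) (X_mem_grading j) hx (dehomogenize i G)) :=
  (ConcreteCategory.congr_hom (Proj.awayMap_awayToSection (𝒜 := grading k) (f := X i)
    (g_deg := X_mem_grading j) (hx := hx)) (dehomogenize i G)).symm

theorem awayMap_dehomogenize_C (i j : Fin 3) {x : S k} (hx : x = X i * X j) (a : k) :
    awayMap (grading k) (X_mem_grading j) hx (dehomogenize i (C a)) =
      fromZeroRingHom (grading k) _ (algebraMap k (grading k 0) a) := by
  rw [dehomogenize_C, awayMap_fromZeroRingHom]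

theorem val_awayMap_dehomogenize_X (i j m : Fin 3) {x : S k} (hx : x = X i * X j) :
    algebraMap (S k) (Localization.Away x) (X i) *
      (awayMap (grading k) (X_mem_grading j) hx (dehomogenize i (X m))).val =
    algebraMap (S k) (Localization.Away x) (X m) := by
  rw [dehomogenize_X, awayMap_mk, Away.val_mk, Localization.mk_eq_mk']
  refine (IsLocalization.mul_mk'_eq_mk'_of_mul _ _ _).trans (IsLocalization.mk'_eq_iff_eq_mul.mpr ?_)
  rw [← map_mul]
  congr 1
  simp only [hx, pow_one]
  ring

theorem restrictHom_basicOpen_C (i j : Fin 3) (a : k)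
    (hi : Proj.basicOpen (grading k) (X i * X j : S k) ≤ (chart k i).1)
    (hj : Proj.basicOpen (grading k) (X i * X j : S k) ≤ (chart k j).1) :
    restrictHom i hi (C a) = restrictHom j hj (C a) := by
  rw [restrictHom_basicOpen i j rfl, restrictHom_basicOpen j i (mul_comm _ _),
    awayMap_dehomogenize_C, awayMap_dehomogenize_C]

/-- The transition rule `X m / X i = (X j / X i) (X m / X j)`, checked after clearing denominators
in the localization at `X i * X j`. -/
theorem restrictHom_basicOpen_X (i j m : Fin 3)
    (hi : Proj.basicOpen (grading k) (X i * X j : S k) ≤ (chart k i).1)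
    (hj : Proj.basicOpen (grading k) (X i * X j : S k) ≤ (chart k j).1) :
    restrictHom i hi (X m) = restrictHom i hi (X j) * restrictHom j hj (X m) := by
  have key : awayMap (grading k) (X_mem_grading j) rfl (dehomogenize i (X m)) =
      awayMap (grading k) (X_mem_grading j) rfl (dehomogenize i (X j)) *
      awayMap (grading k) (X_mem_grading i) (mul_comm _ _) (dehomogenize j (X m)) := by
    refine val_injective _ ?_
    have hu : IsUnit (algebraMap (S k) (Localization.Away (X i * X j : S k)) (X i * X j)) :=
      IsLocalization.Away.algebraMap_isUnit _
    rw [val_mul]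
    have e1 := val_awayMap_dehomogenize_X (k := k) i j m rfl
    have e2 := val_awayMap_dehomogenize_X (k := k) i j j rfl
    have e3 := val_awayMap_dehomogenize_X (k := k) j i m (mul_comm (X i) (X j))
    refine hu.mul_left_cancel ?_
    rw [map_mul]
    linear_combination (algebraMap (S k) (Localization.Away (X i * X j : S k)) (X j)) * e1 -
      (algebraMap (S k) (Localization.Away (X i * X j : S k)) (X j)) *
      (awayMap (grading k) (X_mem_grading i) (mul_comm _ _) (dehomogenize j (X m))).val * e2 -
      (algebraMap (S k) (Localization.Away (X i * X j : S k)) (X j)) * e3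
  exact (restrictHom_basicOpen i j rfl hi _).trans ((congrArg _ key).trans
    ((map_mul (Proj.awayToSection (grading k) (X i * X j : S k)).hom _ _).trans
    (congrArg₂ (· * ·) (restrictHom_basicOpen i j rfl hi _).symm
      (restrictHom_basicOpen j i (mul_comm _ _) hj _).symm)))

/-- On an overlap of charts, the two local equations of a form differ by a unit. -/
theorem restrictHom_of_isHomogeneous {i j : Fin 3} {F : S k} {d : ℕ} (hF : F.IsHomogeneous d) :
    restrictHom i (inf_le_left : (chart k i).1 ⊓ (chart k j).1 ≤ _) F =
      restrictHom i (inf_le_left : (chart k i).1 ⊓ (chart k j).1 ≤ _) (X j) ^ d *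
        restrictHom j (inf_le_right : (chart k i).1 ⊓ (chart k j).1 ≤ _) F := by
  have hle : (chart k i).1 ⊓ (chart k j).1 ≤ Proj.basicOpen (grading k) (X i * X j : S k) :=
    (Proj.basicOpen_mul (grading k) (X i) (X j)).ge
  have hi : Proj.basicOpen (grading k) (X i * X j : S k) ≤ (chart k i).1 :=
    Proj.basicOpen_mono _ _ _ (dvd_mul_right _ _)
  have hj : Proj.basicOpen (grading k) (X i * X j : S k) ≤ (chart k j).1 :=
    Proj.basicOpen_mono _ _ _ (dvd_mul_left _ _)
  have hres : ∀ (l : Fin 3) (hl : Proj.basicOpen (grading k) (X i * X j : S k) ≤ (chart k l).1) G,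
      restrictHom l (hle.trans hl) G =
        ((P2 k).presheaf.map (homOfLE hle).op).hom (restrictHom l hl G) := fun l hl G =>
    (ConcreteCategory.congr_hom ((P2 k).presheaf.map_comp (homOfLE hl).op (homOfLE hle).op)
      (localEquation l G))
  refine ringHom_apply_of_isHomogeneous (fun a => ?_) (fun m => ?_) hF
  · rw [hres i hi, hres j hj, restrictHom_basicOpen_C]
  · rw [hres i hi, hres i hi, hres j hj, restrictHom_basicOpen_X i j m hi hj, map_mul]

/-- The transition rule for the form `X i` reads `1 = (X j / X i) (X i / X j)`. -/
theorem isUnit_restrictHom_X (i j : Fin 3) :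
    IsUnit (restrictHom i (inf_le_left : (chart k i).1 ⊓ (chart k j).1 ≤ _) (X j)) := by
  have h1 := restrictHom_of_isHomogeneous (i := i) (j := j) (isHomogeneous_X k i)
  have h2 : ∀ l {U : (P2 k).Opens} (h : U ≤ (chart k l).1), restrictHom l h (X l) = 1 := by
    intro l U h
    rw [restrictHom, RingHom.comp_apply, localEquationHom_apply, localEquation_X_self, map_one]
  rw [h2, pow_one] at h1
  exact IsUnit.of_mul_eq_one _ h1.symm

end Charts

end PlaneRam

namespace PlaneRam

open MvPolynomial

universe u

/-! ### Local equations of the schemes in (2) and the equality of divisors. -/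

section Curve

open AlgebraicGeometry CategoryTheory

variable {k : Type u} [Field k]

theorem adjoin_range_X : Algebra.adjoin (grading k 0) (Set.range (X : Fin 3 → S k)) = ⊤ := by
  rw [eq_top_iff]
  intro f _
  induction f using MvPolynomial.induction_on with
  | C a =>
    exact Subalgebra.algebraMap_mem (Algebra.adjoin (grading k 0) (Set.range (X : Fin 3 → S k)))
      (⟨C a, isHomogeneous_C _ a⟩ : grading k 0)
  | add p q hp hq => exact add_mem (hp trivial) (hq trivial)
  | mul_X p i hp => exact mul_mem (hp trivial) (Algebra.subset_adjoin ⟨i, rfl⟩)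

theorem iSup_chart : ⨆ i, (chart k i).1 = ⊤ :=
  Proj.iSup_basicOpen_eq_top' (grading k) X (fun i => ⟨1, X_mem_grading i⟩) adjoin_range_X

instance : (P2 k).IsSeparated :=
  inferInstanceAs (Scheme.IsSeparated (Proj (grading k)))

theorem map_chartIdeal (i : Fin 3) {U : (P2 k).Opens} (h : U ≤ (chart k i).1) (T : Set (S k)) :
    (chartIdeal i T).map ((P2 k).presheaf.map (homOfLE h).op).hom =
      Ideal.span (restrictHom i h '' T) := by
  rw [chartIdeal, Ideal.map_span, Set.image_image]
  rfl

/-- Under this compatibility an ideal sheaf with exactly the prescribed ideals exists. It belongs to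
the family whose supremum defines `cutOut`, so the bound is attained. -/
theorem cutOut_ideal {T : Fin 3 → Set (S k)}
    (h : ∀ i j, ∀ F ∈ T j, restrictHom j (inf_le_right : (chart k i).1 ⊓ (chart k j).1 ≤ _) F ∈
      Ideal.span (restrictHom i (inf_le_left : (chart k i).1 ⊓ (chart k j).1 ≤ _) '' T i))
    (i : Fin 3) : (cutOut T).ideal (chart k i) = chartIdeal i (T i) := by
  obtain ⟨I, hI⟩ := exists_idealSheafData (chart k) (fun i => chartIdeal i (T i)) fun i j => by
    rw [map_chartIdeal, map_chartIdeal, Ideal.span_le]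
    rintro _ ⟨F, hF, rfl⟩
    exact h i j F hF
  refine le_antisymm ?_ ?_
  · rw [cutOut, Scheme.IdealSheafData.ideal_sSup, sSup_apply]
    refine iSup_le ?_
    rintro ⟨_, J, hJ, rfl⟩
    exact hJ i
  · rw [← hI]
    have hle : I ≤ cutOut T := le_sSup (show I ∈ {I : (P2 k).IdealSheafData |
      ∀ i, I.ideal (chart k i) ≤ chartIdeal i (T i)} from fun j => (hI j).le)
    exact hle (chart k i)

theorem restrictHom_mem_iff {i j : Fin 3} {F : S k} {d : ℕ} (hF : F.IsHomogeneous d)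
    (J : Ideal Γ(P2 k, (chart k i).1 ⊓ (chart k j).1)) :
    restrictHom j inf_le_right F ∈ J ↔ restrictHom i inf_le_left F ∈ J := by
  rw [restrictHom_of_isHomogeneous hF, Ideal.unit_mul_mem_iff_mem _ ((isUnit_restrictHom_X i j).pow d)]

theorem cutOut_ideal_of_isHomogeneous {T : Set (S k)} (hT : ∀ F ∈ T, ∃ d, F.IsHomogeneous d)
    (i : Fin 3) : (cutOut fun _ => T).ideal (chart k i) = chartIdeal i T := by
  refine cutOut_ideal (fun i j F hF => ?_) i
  obtain ⟨d, hd⟩ := hT F hF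
  rw [restrictHom_mem_iff hd]
  exact Ideal.subset_span ⟨F, hF, rfl⟩

theorem intersection_ideal {F P : S k} {f p : ℕ} (hF : F.IsHomogeneous f) (hP : P.IsHomogeneous p)
    (i : Fin 3) : (intersection F P).ideal (chart k i) = chartIdeal i {F, P} := by
  refine cutOut_ideal_of_isHomogeneous ?_ i
  rintro _ (rfl | rfl)
  exacts [⟨f, hF⟩, ⟨p, hP⟩]

theorem curveIdeal_ideal {P : S k} {p : ℕ} (hP : P.IsHomogeneous p) (i : Fin 3) :
    (curveIdeal P).ideal (chart k i) = Ideal.span {localEquation i P} := by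
  rw [curveIdeal, cutOut_ideal_of_isHomogeneous, chartIdeal, Set.image_singleton]
  rintro _ rfl
  exact ⟨p, hP⟩

theorem span_image_wronskians {R : Type*} [CommRing R] (α : S k →+* R) (P : S k)
    {V : Submodule k (S k)} {r : ℕ} (b : Module.Basis (Fin (r + 1)) k V)
    (D : Derivation k (S k) (S k)) :
    Ideal.span (α '' ({P} ∪ wronskians D V)) =
      Ideal.span {α P, α (wronskian D fun j => (b j : S k))} := by
  refine le_antisymm (Ideal.span_le.mpr ?_) (Ideal.span_le.mpr ?_)
  · rintro _ ⟨F, rfl | hF, rfl⟩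
    · exact Ideal.subset_span (by simp)
    · obtain ⟨a, rfl⟩ := exists_wronskian_eq_C_mul b D hF
      rw [map_mul]
      exact Ideal.mul_mem_left _ _ (Ideal.subset_span (by simp))
  · rintro _ (rfl | rfl)
    · exact Ideal.subset_span ⟨P, Or.inl rfl, rfl⟩
    · exact Ideal.subset_span ⟨_, Or.inr ⟨r, b, rfl⟩, rfl⟩

/-- Modulo `P`, the Wronskians for `X i` and `X j` agree after multiplication by powers of `X j` and
`X i`. On the overlap `X i` becomes `1`, which gives the required containment. -/
theorem ramificationScheme_ideal {P : S k} {p : ℕ} (hP : P.IsHomogeneous p)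
    {V : Submodule k (S k)} {e : ℕ} (hV : V ≤ grading k e) {r : ℕ}
    (b : Module.Basis (Fin (r + 1)) k V) (i : Fin 3) :
    (ramificationScheme P V).ideal (chart k i) =
      chartIdeal i {P, wronskian (del P (X i)) fun j => (b j : S k)} := by
  have hb : ∀ j, (b j : S k).IsHomogeneous e := fun j => hV (b j).2
  have hT : ∀ i, chartIdeal i ({P} ∪ wronskians (del P (X i)) V) =
      chartIdeal i {P, wronskian (del P (X i)) fun j => (b j : S k)} := fun i => by
    rw [chartIdeal, chartIdeal, Set.image_pair]
    exact span_image_wronskians (localEquationHom i) P b _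
  rw [← hT]
  refine cutOut_ideal (fun i j F hF => ?_) i
  have h1 : restrictHom j (inf_le_right : (chart k i).1 ⊓ (chart k j).1 ≤ _) F ∈
      Ideal.span (restrictHom j (inf_le_right : (chart k i).1 ⊓ (chart k j).1 ≤ _) ''
        ({P} ∪ wronskians (del P (X j)) V)) := Ideal.subset_span ⟨F, hF, rfl⟩
  rw [span_image_wronskians _ P b] at h1 ⊢
  refine Ideal.span_le.mpr ?_ h1
  rintro _ (rfl | rfl)
  · rw [SetLike.mem_coe, restrictHom_mem_iff hP]
    exact Ideal.subset_span (by simp)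
  · obtain ⟨d, hd⟩ := exists_isHomogeneous_wronskian
      (isHomogeneousDerivation_del hP (isHomogeneous_X k j)) hb
    rw [SetLike.mem_coe, restrictHom_mem_iff hd]
    have h2 := map_dvd (restrictHom i (inf_le_left : (chart k i).1 ⊓ (chart k j).1 ≤ _))
      (wronskian_del_dvd_sub hP (isHomogeneous_X k i) (isHomogeneous_X k j) hb)
    obtain ⟨c, hc⟩ := h2
    have hX : restrictHom i (inf_le_left : (chart k i).1 ⊓ (chart k j).1 ≤ _) (X i) = 1 := by
      rw [restrictHom, RingHom.comp_apply, localEquationHom_apply, localEquation_X_self, map_one]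
    simp only [map_sub, map_mul, map_pow, hX, Nat.cast_one, one_mul, one_pow] at hc
    rw [Ideal.mem_span_pair]
    exact ⟨-c, restrictHom i inf_le_left (X j) ^ Nat.choose (r + 1) 2, by linear_combination hc⟩

instance (P : S k) : IsClosedImmersion (curveι P) :=
  inferInstanceAs (IsClosedImmersion (curveIdeal P).subschemeι)

/-- The affine open subset `X i ≠ 0` of the curve `P = 0`. -/
noncomputable def curveChart (P : S k) (i : Fin 3) : (curve P).affineOpens :=
  ⟨curveι P ⁻¹ᵁ (chart k i).1, (chart k i).2.preimage (curveι P)⟩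

theorem iSup_curveChart (P : S k) : ⨆ i, (curveChart P i).1 = ⊤ := by
  have := congrArg (fun U => curveι P ⁻¹ᵁ U) (iSup_chart (k := k))
  simp only [Scheme.Hom.preimage_iSup] at this
  exact this

/-- The regular function that a polynomial defines on a chart of the curve `P = 0`. -/
noncomputable def curveHom (P : S k) (i : Fin 3) : S k →+* Γ(curve P, (curveChart P i).1) :=
  ((curveι P).app (chart k i).1).hom.comp (localEquationHom i)

theorem curveι_app_eq_zero_iff {P : S k} {p : ℕ} (hP : P.IsHomogeneous p) (i : Fin 3)
    (a : Γ(P2 k, (chart k i).1)) :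
    ((curveι P).app (chart k i).1).hom a = 0 ↔ localEquation i P ∣ a := by
  rw [← Ideal.mem_span_singleton, ← curveIdeal_ideal hP,
    ← Scheme.IdealSheafData.ker_subschemeι_app]
  rfl

theorem curveHom_X_self (P : S k) (i : Fin 3) : curveHom P i (X i) = 1 :=
  (congrArg _ (localEquation_X_self i)).trans (map_one ((curveι P).app (chart k i).1).hom)

theorem curveHom_self {P : S k} {p : ℕ} (hP : P.IsHomogeneous p) (i : Fin 3) :
    curveHom P i P = 0 :=
  (curveι_app_eq_zero_iff hP i _).mpr dvd_rfl

theorem curveHom_mem_nonZeroDivisors {P Q : S k} {p q : ℕ} (hP : P.IsHomogeneous p)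
    (hQ : Q.IsHomogeneous q) (hQP : IsRelPrime Q P) (i : Fin 3) :
    curveHom P i Q ∈ nonZeroDivisors Γ(curve P, (curveChart P i).1) := by
  refine mem_nonZeroDivisors_iff_left.mpr fun x hx => ?_
  obtain ⟨a, rfl⟩ := (curveι P).app_surjective (chart k i).1 (chart k i).2 x
  refine (curveι_app_eq_zero_iff hP i a).mpr (localEquation_dvd_of_dvd_mul hP hQ hQP ?_)
  rw [← curveι_app_eq_zero_iff hP, map_mul]
  exact hx

theorem onCurve_ideal {P F : S k} {p : ℕ} (hP : P.IsHomogeneous p) {I : (P2 k).IdealSheafData}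
    {i : Fin 3} (hI : I.ideal (chart k i) = chartIdeal i {F, P}) :
    (onCurve P I).ideal (curveChart P i) = Ideal.span {curveHom P i F} := by
  refine (ideal_comap_of_isClosedImmersion I (curveι P) (chart k i)).trans ?_
  rw [hI, chartIdeal, Set.image_pair, Ideal.map_span, Set.image_pair]
  have : ((curveι P).app (chart k i).1).hom (localEquation i P) = 0 := curveHom_self hP i
  erw [this]
  rw [Set.pair_comm]
  exact Submodule.span_insert_zero

theorem isEffectiveCartier_of_forall {P : S k} {I : (curve P).IdealSheafData} {F : Fin 3 → S k}
    (hI : ∀ i, I.ideal (curveChart P i) = Ideal.span {curveHom P i (F i)})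
    (hF : ∀ i, curveHom P i (F i) ∈ nonZeroDivisors _) : IsEffectiveCartier I := by
  intro y
  have hy : y ∈ ⨆ i, (curveChart P i).1 := by rw [iSup_curveChart]; trivial
  obtain ⟨i, hi⟩ := TopologicalSpace.Opens.mem_iSup.mp hy
  exact ⟨curveChart P i, hi, _, hF i, hI i⟩

theorem isEffectiveCartier_intersection {P Q : S k} {p q : ℕ} (hP : P.IsHomogeneous p)
    (hQ : Q.IsHomogeneous q) (hQP : IsRelPrime Q P) :
    IsEffectiveCartier (onCurve P (intersection Q P)) :=
  isEffectiveCartier_of_forall (fun i => onCurve_ideal hP (intersection_ideal hQ hP i))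
    fun i => curveHom_mem_nonZeroDivisors hP hQ hQP i

theorem onCurve_ramificationScheme_ideal {P : S k} {p : ℕ} (hP : P.IsHomogeneous p)
    {V : Submodule k (S k)} {e : ℕ} (hV : V ≤ grading k e) {r : ℕ}
    (b : Module.Basis (Fin (r + 1)) k V) (i : Fin 3) :
    (onCurve P (ramificationScheme P V)).ideal (curveChart P i) =
      Ideal.span {curveHom P i (wronskian (del P (X i)) fun j => (b j : S k))} :=
  onCurve_ideal hP (by rw [ramificationScheme_ideal hP hV b, Set.pair_comm])

/-- The Wronskian congruence for `Q` and `X i`, read where `P = 0` and `X i = 1`. This is the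
divisor formula in local form. -/
theorem curveHom_wronskian_del {P Q : S k} {p q : ℕ} (hP : P.IsHomogeneous p)
    (hQ : Q.IsHomogeneous q) {r : ℕ} {v : Fin (r + 1) → S k} {e : ℕ}
    (hv : ∀ j, (v j).IsHomogeneous e) (i : Fin 3) :
    curveHom P i (wronskian (del P Q) v) =
      ((q : Γ(curve P, (curveChart P i).1)) * curveHom P i Q) ^ Nat.choose (r + 1) 2 *
        curveHom P i (wronskian (del P (X i)) v) := by
  have h := map_dvd (curveHom P i) (wronskian_del_dvd_sub hP hQ (isHomogeneous_X k i) hv)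
  rw [curveHom_self hP, zero_dvd_iff] at h
  simp only [map_sub, map_mul, map_pow, curveHom_X_self, Nat.cast_one, one_mul, one_pow,
    map_natCast, sub_eq_zero] at h
  exact h

/-- The local equation is a factor of `W_{∂_{P,Q}}`, which is a nonzerodivisor because it is prime
to `P`. -/
theorem isEffectiveCartier_ramificationScheme {P Q : S k} {p q : ℕ} (hP : P.IsHomogeneous p)
    (hQ : Q.IsHomogeneous q) {V : Submodule k (S k)} {e : ℕ} (hV : V ≤ grading k e) {r : ℕ}
    (b : Module.Basis (Fin (r + 1)) k V)
    (h : IsRelPrime (wronskian (del P Q) fun j => (b j : S k)) P) :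
    IsEffectiveCartier (onCurve P (ramificationScheme P V)) := by
  have hb : ∀ j, (b j : S k).IsHomogeneous e := fun j => hV (b j).2
  refine isEffectiveCartier_of_forall (onCurve_ramificationScheme_ideal hP hV b) fun i => ?_
  obtain ⟨d, hd⟩ := exists_isHomogeneous_wronskian (isHomogeneousDerivation_del hP hQ) hb
  have h1 := curveHom_mem_nonZeroDivisors hP hd h i
  rw [curveHom_wronskian_del hP hQ hb] at h1
  exact (mul_mem_nonZeroDivisors.mp h1).2

theorem onCurve_intersection_wronskian [CharZero k] {P Q : S k} {p q : ℕ}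
    (hP : P.IsHomogeneous p) (hQ : Q.IsHomogeneous q) (hq : 0 < q) {V : Submodule k (S k)} {e : ℕ}
    (hV : V ≤ grading k e) {r : ℕ} (b : Module.Basis (Fin (r + 1)) k V) :
    onCurve P (intersection (wronskian (del P Q) fun j => (b j : S k)) P) =
      onCurve P (ramificationScheme P V) * onCurve P (intersection Q P) ^ Nat.choose (r + 1) 2 := by
  have hb : ∀ j, (b j : S k).IsHomogeneous e := fun j => hV (b j).2
  obtain ⟨d, hd⟩ := exists_isHomogeneous_wronskian (isHomogeneousDerivation_del hP hQ) hb
  refine Scheme.IdealSheafData.ext_of_iSup_eq_top (curveChart P) (iSup_curveChart P) fun i => ?_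
  rw [Scheme.IdealSheafData.ideal_mul, Scheme.IdealSheafData.ideal_pow, Pi.mul_apply, Pi.pow_apply,
    onCurve_ideal hP (intersection_ideal hd hP i), onCurve_ramificationScheme_ideal hP hV b,
    onCurve_ideal hP (intersection_ideal hQ hP i), Ideal.span_singleton_pow,
    Ideal.span_singleton_mul_span_singleton, curveHom_wronskian_del hP hQ hb]
  have hu : IsUnit (q : Γ(curve P, (curveChart P i).1)) := by
    have h1 : IsUnit (q : k) := IsUnit.mk0 _ (Nat.cast_ne_zero.mpr hq.ne')
    simpa using h1.map ((curveHom P i).comp C)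
  rw [mul_pow, mul_assoc, mul_comm, Ideal.span_singleton_mul_right_unit (hu.pow _),
    mul_comm (curveHom P i Q ^ _)]

end Curve

end PlaneRam

namespace PlaneRam

open MvPolynomial

universe u

/-! ### Finiteness of the ramification scheme. -/

section Finite

open AlgebraicGeometry CategoryTheory HomogeneousLocalization

variable {k : Type u} [Field k]

instance : Algebra.FiniteType (grading k 0) (S k) :=
  ⟨⟨(Set.finite_range (X : Fin 3 → S k)).toFinset, by
    rw [Set.Finite.coe_toFinset, adjoin_range_X]⟩⟩

theorem fromSpec_toSpecZero (i : Fin 3) :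
    (Proj.isAffineOpen_basicOpen (grading k) (X i) (X_mem_grading i) one_pos).fromSpec ≫
      Proj.toSpecZero (grading k) =
    Spec.map (CommRingCat.ofHom (fromZeroRingHom (grading k) _) ≫
      Proj.awayToSection (grading k) (X i)) := by
  have hU := Proj.isAffineOpen_basicOpen (grading k) (X i) (X_mem_grading i) one_pos
  have h1 : Spec.map (Proj.awayToSection (grading k) (X i)) ≫
      Proj.awayι (grading k) (X i) (X_mem_grading i) one_pos = hU.fromSpec := by
    rw [← cancel_epi hU.isoSpec.hom, hU.isoSpec_hom_fromSpec, IsAffineOpen.isoSpec_hom]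
    have h4 : (Proj.basicOpen (grading k) (X i)).toSpecΓ ≫
        Spec.map (Proj.awayToSection (grading k) (X i)) =
        (Proj.basicOpenIsoSpec (grading k) (X i) (X_mem_grading i) one_pos).hom :=
      (Proj.basicOpenIsoSpec_hom (grading k) (X i) (X_mem_grading i) one_pos).symm
    rw [← Category.assoc, h4, Proj.awayι, Iso.hom_inv_id_assoc]
  rw [← h1, Category.assoc, Proj.awayι_toSpecZero, ← Spec.map_comp]

theorem fromSpec_toSpec (i : Fin 3) : (chart k i).2.fromSpec ≫ P2.toSpec k =
    Spec.map (CommRingCat.ofHom ((localEquationHom i).comp C)) := by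
  have h : Spec.map (CommRingCat.ofHom (fromZeroRingHom (grading k) _) ≫
      Proj.awayToSection (grading k) (X i)) ≫
      Spec.map (CommRingCat.ofHom (algebraMap k (grading k 0))) =
      Spec.map (CommRingCat.ofHom ((localEquationHom i).comp C)) := by
    rw [← Spec.map_comp]
    congr 1
    ext a
    exact congrArg (Proj.awayToSection (grading k) (X i)).hom (dehomogenize_C i a).symm
  refine Eq.trans ?_ h
  exact (Category.assoc _ _ _).symm.trans (congrArg (· ≫ _) (fromSpec_toSpecZero i))

theorem locallyQuasiFinite_specMap_iff {A : Type u} [CommRing A] (f : k →+* A) :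
    LocallyQuasiFinite (Spec.map (CommRingCat.ofHom f)) ↔ f.Finite := by
  rw [HasRingHomProperty.Spec_iff (P := @LocallyQuasiFinite)]
  refine ⟨fun h => ?_, fun h => .of_finite h⟩
  have hf : f.QuasiFinite := h
  algebraize [f]
  exact Module.Finite.of_quasiFinite

instance : IsZariskiLocalAtSource.{u} @LocallyQuasiFinite :=
  HasRingHomProperty.instIsZariskiLocalAtSource (P := @LocallyQuasiFinite)

theorem locallyQuasiFinite_iff (I : (P2 k).IdealSheafData) :
    LocallyQuasiFinite (I.subschemeι ≫ P2.toSpec k) ↔ ∀ i,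
      ((Ideal.Quotient.mk (I.ideal (chart k i))).comp ((localEquationHom i).comp C)).Finite := by
  have hopen : ∀ i, IsOpenImmersion (I.subschemeCover.f (chart k i)) :=
    fun i => I.subschemeCover.map_prop (chart k i)
  have hf : ∀ i, LocallyQuasiFinite (I.subschemeCover.f (chart k i) ≫ I.subschemeι ≫
      P2.toSpec k) ↔
      ((Ideal.Quotient.mk (I.ideal (chart k i))).comp ((localEquationHom i).comp C)).Finite := by
    intro i
    have h : I.subschemeCover.f (chart k i) ≫ I.subschemeι ≫ P2.toSpec k =
        Spec.map (CommRingCat.ofHom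
          ((Ideal.Quotient.mk (I.ideal (chart k i))).comp ((localEquationHom i).comp C))) := by
      rw [CommRingCat.ofHom_comp, Spec.map_comp, ← fromSpec_toSpec, ← Category.assoc,
        ← Category.assoc]
      congr 1
      exact (I.subschemeCover_map_subschemeι _).trans (I.glueDataObjι_ι _)
    rw [h]
    exact locallyQuasiFinite_specMap_iff _
  let 𝒰 : I.subscheme.OpenCover := Scheme.Cover.mkOfCovers (P := @IsOpenImmersion) (Fin 3)
    (fun i => I.subschemeCover.openCover.X (chart k i)) (fun i => I.subschemeCover.f (chart k i))
    (fun x => by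
      have hx : I.subschemeι x ∈ ⨆ i, (chart k i).1 := by rw [iSup_chart]; trivial
      obtain ⟨i, hi⟩ := TopologicalSpace.Opens.mem_iSup.mp hx
      have h2 : x ∈ (I.subschemeCover.f (chart k i)).opensRange := by
        rw [Scheme.IdealSheafData.opensRange_subschemeCover_map]
        exact hi
      obtain ⟨y, hy⟩ := h2
      exact ⟨i, y, hy⟩)
    hopen
  exact (IsZariskiLocalAtSource.iff_of_openCover 𝒰).trans (forall_congr' hf)

/-- Finiteness is not local on the source, but local quasi-finiteness is. Over the artinian base
`Spec k` it implies finiteness for this quasi-compact morphism. -/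
theorem isFiniteSubscheme_iff (I : (P2 k).IdealSheafData) : IsFiniteSubscheme I ↔ ∀ i,
    ((Ideal.Quotient.mk (I.ideal (chart k i))).comp ((localEquationHom i).comp C)).Finite := by
  rw [← locallyQuasiFinite_iff]
  refine ⟨fun h => ?_, fun h => ?_⟩
  · have : IsFinite (I.subschemeι ≫ P2.toSpec k) := h
    infer_instance
  · have : QuasiCompact (P2.toSpec k) :=
      inferInstanceAs (QuasiCompact (Proj.toSpecZero (grading k) ≫
        Spec.map (CommRingCat.ofHom (algebraMap k (grading k 0)))))
    have : IsLocallyArtinian (Spec (.of k)) := by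
      rw [Scheme.isLocallyArtinianScheme_Spec]
      exact inferInstanceAs (IsArtinianRing k)
    exact IsFinite.of_locallyQuasiFinite _

theorem finite_quotient_chartIdeal {P W : S k} (hP0 : P ≠ 0) {p w : ℕ} (hP : P.IsHomogeneous p)
    (hW : W.IsHomogeneous w) (i : Fin 3)
    (h : ∀ E : S k, Irreducible E → E ∣ P → E ∣ W → E ∣ X i) :
    ((Ideal.Quotient.mk (chartIdeal i {P, W})).comp ((localEquationHom i).comp C)).Finite := by
  have h1 := finite_quotient_span hP0 hP hW i h
  have h2 : ∀ x ∈ Ideal.span {P, W, X i - 1},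
      (Ideal.Quotient.mk (chartIdeal i {P, W})).comp (localEquationHom i) x = 0 := by
    intro x hx
    rw [← RingHom.mem_ker]
    refine (Ideal.span_le.mpr ?_) hx
    rintro y (rfl | rfl | rfl)
    · exact Ideal.Quotient.eq_zero_iff_mem.mpr (Ideal.subset_span ⟨y, by simp, rfl⟩)
    · exact Ideal.Quotient.eq_zero_iff_mem.mpr (Ideal.subset_span ⟨y, by simp, rfl⟩)
    · rw [SetLike.mem_coe, RingHom.mem_ker, RingHom.comp_apply, map_sub, map_one,
        localEquationHom_apply, localEquation_X_self, sub_self, map_zero]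
  let g := Ideal.Quotient.lift _ _ h2
  have hg : Function.Surjective g := Ideal.Quotient.lift_surjective_of_surjective _ _
    (Ideal.Quotient.mk_surjective.comp (localEquation_surjective i))
  have h3 : (algebraMap k (S k ⧸ Ideal.span {P, W, X i - 1})).Finite :=
    RingHom.finite_algebraMap.mpr h1
  exact (RingHom.Finite.of_surjective g hg).comp h3

/-- Finiteness would make `X j / X i` integral over `k`, with `j` the third index. Homogenizing its
equation, `E` would divide a nonzero form in `X i` and `X j` alone, although `E` involves `X l`. -/
theorem not_finite_quotient_chartIdeal {E P W : S k} {e : ℕ}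
    (hEh : E.IsHomogeneous e) (hEP : E ∣ P) (hEW : E ∣ W) {l i : Fin 3} (hl : degreeOf l E ≠ 0)
    (hil : i ≠ l) :
    ¬ ((Ideal.Quotient.mk (chartIdeal i {P, W})).comp ((localEquationHom i).comp C)).Finite := by
  intro h
  obtain ⟨j, hji, hjl, -⟩ := exists_third i l hil
  obtain ⟨f, hf, hfX⟩ := h.to_isIntegral
    (Ideal.Quotient.mk (chartIdeal i {P, W}) (localEquation i (X j)))
  let F : S k := ∑ n ∈ Finset.range (f.natDegree + 1),
    C (f.coeff n) * (X j ^ n * X i ^ (f.natDegree - n))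
  have hF : F.IsHomogeneous f.natDegree := by
    refine IsHomogeneous.sum _ _ _ fun n hn => ?_
    refine IsHomogeneous.C_mul ?_ _
    have h1 := ((isHomogeneous_X k j).pow n).mul ((isHomogeneous_X k i).pow (f.natDegree - n))
    rwa [one_mul, one_mul, Nat.add_sub_cancel' (Finset.mem_range_succ_iff.mp hn)] at h1
  have hF0 : F ≠ 0 := by
    intro h0
    -- Setting `X j` to the variable and the other coordinates to `1` recovers the monic polynomial
    -- `f`.
    have h1 := congrArg (aeval fun m => if m = j then (Polynomial.X : Polynomial k) else 1) h0
    rw [map_zero, map_sum] at h1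
    simp only [map_mul, map_pow, aeval_X, if_true, if_neg hji.symm, one_pow, mul_one,
      ← algebraMap_eq, AlgHom.commutes, Polynomial.algebraMap_apply, Algebra.algebraMap_self,
      RingHom.id_apply] at h1
    rw [← Polynomial.as_sum_range_C_mul_X_pow] at h1
    exact hf.ne_zero h1
  have hFmem : localEquation i E ∣ localEquation i F := by
    have hle : chartIdeal i {P, W} ≤ Ideal.span {localEquation i E} := by
      rw [chartIdeal, Ideal.span_le]
      rintro _ ⟨G, rfl | rfl, rfl⟩
      · exact Ideal.mem_span_singleton.mpr (map_dvd (localEquationHom i) hEP)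
      · exact Ideal.mem_span_singleton.mpr (map_dvd (localEquationHom i) hEW)
    refine Ideal.mem_span_singleton.mp (hle (Ideal.Quotient.eq_zero_iff_mem.mp ?_))
    rw [← hfX, Polynomial.eval₂_eq_sum_range, ← localEquationHom_apply, map_sum, map_sum]
    refine Finset.sum_congr rfl fun n _ => ?_
    simp only [map_mul, map_pow, RingHom.comp_apply, localEquationHom_apply,
      localEquation_X_self, one_pow, mul_one]
  obtain ⟨m, hm⟩ := pow_dvd_of_localEquation_dvd hF hEh hFmem
  refine hl (Nat.le_zero.mp ((degreeOf_le_of_dvd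
    (mul_ne_zero (pow_ne_zero m (X_ne_zero i)) hF0) hm l).trans ?_))
  have hX : ∀ (a : Fin 3), a ≠ l → ∀ n, degreeOf l (X a ^ n : S k) ≤ 0 := fun a ha n =>
    (degreeOf_pow_le _ _ _).trans (by rw [degreeOf_X_of_ne ha.symm, mul_zero])
  have hmul : ∀ {f g : S k}, degreeOf l f ≤ 0 → degreeOf l g ≤ 0 → degreeOf l (f * g) ≤ 0 :=
    fun hf hg => (degreeOf_mul_le _ _ _).trans (by omega)
  refine hmul (hX i hil m) ((degreeOf_sum_le _ _ _).trans (Finset.sup_le fun n _ => ?_))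
  exact (degreeOf_C_mul_le _ _ _).trans (hmul (hX j hjl n) (hX i hil _))

theorem isFiniteSubscheme_ramificationScheme_iff [CharZero k] {P Q : S k} {p q : ℕ}
    (hP : P.IsHomogeneous p) (hP0 : P ≠ 0) (hQ : Q.IsHomogeneous q) (hq : 0 < q)
    (hQP : IsRelPrime Q P) {V : Submodule k (S k)} {e : ℕ} (hV : V ≤ grading k e) {r : ℕ}
    (b : Module.Basis (Fin (r + 1)) k V) :
    IsFiniteSubscheme (ramificationScheme P V) ↔
      IsRelPrime (wronskian (del P Q) fun j => (b j : S k)) P := by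
  have hb : ∀ j, (b j : S k).IsHomogeneous e := fun j => hV (b j).2
  have hqu : IsUnit (q : S k) := by
    rw [← map_natCast (C : k →+* S k)]
    exact (IsUnit.mk0 _ (Nat.cast_ne_zero.mpr hq.ne')).map C
  have hcong : ∀ i, P ∣ (X i : S k) ^ Nat.choose (r + 1) 2 *
      wronskian (del P Q) (fun j => (b j : S k)) - ((q : S k) * Q) ^ Nat.choose (r + 1) 2 *
      wronskian (del P (X i)) (fun j => (b j : S k)) := fun i => by
    simpa using wronskian_del_dvd_sub hP hQ (isHomogeneous_X k i) hb
  rw [isFiniteSubscheme_iff]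
  rw [show (∀ i, ((Ideal.Quotient.mk ((ramificationScheme P V).ideal (chart k i))).comp
      ((localEquationHom i).comp C)).Finite) ↔ ∀ i, ((Ideal.Quotient.mk (chartIdeal i
      {P, wronskian (del P (X i)) fun j => (b j : S k)})).comp ((localEquationHom i).comp C)).Finite
    from forall_congr' fun i => by rw [ramificationScheme_ideal hP hV b]]
  refine ⟨fun h F hFW hFP => ?_, fun h i => ?_⟩
  · by_contra hu
    obtain ⟨E, hE, hEF⟩ := WfDvdMonoid.exists_irreducible_factor hu (ne_zero_of_dvd_ne_zero hP0 hFP)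
    have hEP := hEF.trans hFP
    obtain ⟨d, hEh⟩ := exists_isHomogeneous_of_irreducible_dvd hE hP0 hP hEP
    obtain ⟨l, hl⟩ := exists_degreeOf_ne_zero hE
    -- A chart with `i ≠ l` meets the component `E = 0` in a positive-dimensional set.
    obtain ⟨i, hil⟩ : ∃ i, l ≠ i := ⟨l + 1, by simp⟩
    refine not_finite_quotient_chartIdeal hEh hEP ?_ hl hil.symm (h i)
    have h1 := (dvd_sub_right ((hEF.trans hFW).mul_left _)).mp (hEP.trans (hcong i))
    refine (hE.prime.dvd_or_dvd h1).resolve_left fun h2 => ?_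
    exact hE.not_isUnit (hQP (hqu.dvd_mul_left.mp (hE.prime.dvd_of_dvd_pow h2)) hEP)
  · obtain ⟨d, hd⟩ := exists_isHomogeneous_wronskian
      (isHomogeneousDerivation_del hP (isHomogeneous_X k i)) hb
    refine finite_quotient_chartIdeal hP0 hP hd i fun E hE hEP hEW => ?_
    -- A common factor for `X i` divides `X i ^ n` times the Wronskian for `Q`. It cannot divide
    -- that Wronskian, so it divides `X i` and is invisible on this chart.
    have h1 := (dvd_sub_left (hEW.mul_left _)).mp (hEP.trans (hcong i))
    rcases hE.prime.dvd_or_dvd h1 with h2 | h2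
    · exact hE.prime.dvd_of_dvd_pow h2
    · exact absurd (h h2 hEP) hE.not_isUnit

end Finite

end PlaneRam

theorem lemma2p3p2 {k : Type*} [Field k] [CharZero k]
    (P : PlaneRam.S k) (p : ℕ) (hP : P.IsHomogeneous p) (hP0 : P ≠ 0)
    (V : Submodule k (PlaneRam.S k)) (e : ℕ) (hV : V ≤ PlaneRam.grading k e)
    (r : ℕ) (b : Module.Basis (Fin (r + 1)) k V) :
    -- (1)
    (∀ (Q₁ Q₂ : PlaneRam.S k) (q₁ q₂ : ℕ), Q₁.IsHomogeneous q₁ → Q₁ ≠ 0 → 0 < q₁ →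
      Q₂.IsHomogeneous q₂ → Q₂ ≠ 0 → 0 < q₂ →
      PlaneRam.ProjEquiv P (Q₂ • PlaneRam.del P Q₁) (Q₁ • PlaneRam.del P Q₂)) ∧
    -- (2), preceded by the fact that the local equations of the ramification scheme glue
    ((∀ i : Fin 3, (PlaneRam.ramificationScheme P V).ideal (PlaneRam.chart k i) =
        PlaneRam.chartIdeal i
          {P, PlaneRam.wronskian (PlaneRam.del P (MvPolynomial.X i)) fun j => (b j : PlaneRam.S k)}) ∧
      ∀ (Q : PlaneRam.S k) (q : ℕ), Q.IsHomogeneous q → Q ≠ 0 → 0 < q → IsRelPrime Q P →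
        (PlaneRam.IsFiniteSubscheme (PlaneRam.ramificationScheme P V) ↔
          IsRelPrime (PlaneRam.wronskian (PlaneRam.del P Q) fun j => (b j : PlaneRam.S k)) P) ∧
        (PlaneRam.IsFiniteSubscheme (PlaneRam.ramificationScheme P V) →
          PlaneRam.IsEffectiveCartier
            (PlaneRam.onCurve P (PlaneRam.ramificationScheme P V)) ∧
          PlaneRam.IsEffectiveCartier
            (PlaneRam.onCurve P (PlaneRam.intersection Q P)) ∧
          PlaneRam.IsEffectiveCartier
            (PlaneRam.onCurve P (PlaneRam.intersection
              (PlaneRam.wronskian (PlaneRam.del P Q) fun j => (b j : PlaneRam.S k)) P)) ∧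
          PlaneRam.onCurve P (PlaneRam.intersection
              (PlaneRam.wronskian (PlaneRam.del P Q) fun j => (b j : PlaneRam.S k)) P) =
            PlaneRam.onCurve P (PlaneRam.ramificationScheme P V) *
              PlaneRam.onCurve P (PlaneRam.intersection Q P) ^ Nat.choose (r + 1) 2)) ∧
    -- (3)
    (Squarefree P → ∀ (Q : PlaneRam.S k) (q : ℕ), Q.IsHomogeneous q → Q ≠ 0 → 0 < q →
      IsRelPrime Q P → PlaneRam.IsPrimeTo (PlaneRam.del P Q) P) ∧
    -- (4)
    (∀ D : Derivation k (PlaneRam.S k) (PlaneRam.S k), PlaneRam.IsDerivationOf P D →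
      PlaneRam.IsPrimeTo D P → Squarefree P → PlaneRam.IsNondegenerate P V →
      IsRelPrime (PlaneRam.wronskian D fun j => (b j : PlaneRam.S k)) P) := by
  have hfin := fun (Q : PlaneRam.S k) (q : ℕ) (hQ : Q.IsHomogeneous q) (hq : 0 < q)
    (hQP : IsRelPrime Q P) =>
    PlaneRam.isFiniteSubscheme_ramificationScheme_iff hP hP0 hQ hq hQP hV b
  refine ⟨fun Q₁ Q₂ q₁ q₂ h₁ _ hq₁ h₂ _ hq₂ => PlaneRam.projEquiv_smul_del hP h₁ hq₁ h₂ hq₂,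
    ⟨PlaneRam.ramificationScheme_ideal hP hV b, fun Q q hQ _ hq hQP =>
      ⟨hfin Q q hQ hq hQP, fun h => ?_⟩⟩,
    fun hPs Q q hQ _ hq hQP => PlaneRam.isPrimeTo_del hP hP0 hPs hQ hq hQP,
    fun D hD hDP hPs hPV => PlaneRam.isRelPrime_wronskian hP hP0 hV b hD hDP hPs hPV⟩
  have hW := (hfin Q q hQ hq hQP).mp h
  obtain ⟨d, hd⟩ := PlaneRam.exists_isHomogeneous_wronskian
    (PlaneRam.isHomogeneousDerivation_del hP hQ) fun j => hV (b j).2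
  exact ⟨PlaneRam.isEffectiveCartier_ramificationScheme hP hQ hV b hW,
    PlaneRam.isEffectiveCartier_intersection hP hQ hQP,
    PlaneRam.isEffectiveCartier_intersection hP hd hW,
    PlaneRam.onCurve_intersection_wronskian hP hQ hq hV b⟩
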